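/- For $n\ge 0$ let $$N_n=\int_{\mathbb R^n}e^{-\sum_j\lambda_j^2}\prod_{j<k}(\lambda_j-\lambda_k)^2\,d\lambda ,$$ let $p(k,n)$ be the probability that exactly $k$ of the $n$ coordinates $\lambda_j$ are positive under the eigenvalue density $N_n^{-1}e^{-\sum_j\lambda_j^2}\prod_{j<k}(\lambda_j-\lambda_k)^2$ of the $n\times n$ Gaussian unitary ensemble, and let $Z_n(s)=\sum_{k=0}^n e^{-sk}p(k,n)$ ($Z_0=1$), for $s\in\mathbb C$. For $\xi\in\mathbb C$ and $t\in\mathbb R$ let $\tau_0=1$ and $$\tau_n(t;0;\xi)=2^{n(n-1)}\det\Big[\Big(\int_{-\infty}^t+\xi\int_t^\infty\Big)(t-x)^{i+j}e^{-x^2}\,dx\Big]_{i,j=0,\dots,n-1},\qquad n\ge1 .$$ 1. For all $n\ge0$, $N_n=2^{-n(n-1)/2}\pi^{n/2}\,n!\,G(n+1)$, where $G(n+1)=\prod_{k=0}^{n-1}k!$ is the Barnes function, and for all $s\in\mathbb C$ $$Z_n(s)=\frac{n!}{2^{n(n-1)}N_n}\,\tau_n(0;0;e^{-s}).$$ 2.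 For every $\xi\in\mathbb C$, $(\tau_n)_{n\ge0}=(\tau_n(\cdot;0;\xi))_{n\ge 0}$ is a classical $\tau$-function sequence of the fourth Painlevé equation with parameters $(\alpha_0,\alpha_1,\alpha_2)=(1+n,0,-n)$. That is: for every $n\ge 0$ there are functions $f_{0,n},f_{1,n},f_{2,n}$, meromorphic in the real variable $t$, with $$f_{0,n}+f_{1,n}+f_{2,n}=2t,$$ $$f_{0,n}'=f_{0,n}(f_{1,n}-f_{2,n})+2(1+n),\quad f_{1,n}'=f_{1,n}(f_{2,n}-f_{0,n}),\quad f_{2,n}'=f_{2,n}(f_{0,n}-f_{1,n})-2n,$$ $$\frac{d}{dt}\log\tau_n=\tfrac12f_{0,n}f_{1,n}f_{2,n}-n f_{1,n}$$ (these hold, with $\tau_n\ne0$, outside a closed discrete set of $t$); $\tau_n$ is twice continuously differentiable in $t$; and, for $n\ge1$ and all $t$ with $\tau_n(t)\neq 0$, the Toda equation $$\frac{d^2}{dt^2}\log\big(e^{nt^2}\tau_n\big)=\frac{\tau_{n+1}\tau_{n-1}}{\tau_n^2}$$ holds. 3. For every $\xi\in\mathbb C$ and $n\ge2$ the values $\tau_n=\tau_n(0;0;\xi)$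 satisfy $$\tau_{n+2}\tau_n^3\tau_{n-2}+\tau_{n+2}\tau_{n-1}^2\big[\tau_{n+1}\tau_{n-1}-(4n-2)\tau_n^2\big]+\tau_{n-2}\tau_{n+1}^2\big[\tau_{n+1}\tau_{n-1}-(4n+2)\tau_n^2\big]$$ $$-4(2n^2+1)\tau_{n+1}^2\tau_n\tau_{n-1}^2+32n^3\tau_{n+1}\tau_n^3\tau_{n-1}-16n^4\tau_n^5=0 .$$ 4. If $\xi>0$ is real, then $\tau_n(0;0;\xi)\ne0$ for all $n\ge 0$. Let $\xi\in\mathbb C$, and for each $n\ge 0$ let $f_{0,n},f_{1,n},f_{2,n}$ be any functions as in 2. Whenever $\tau_n(0;0;\xi)\ne0$ the limit $g_n=\lim_{t\to0,\,t\ne0}f_{1,n}(t)f_{2,n}(t)$ (the value of $f_{1,n}f_{2,n}$ at $t=0$) exists, and for every $n\ge1$ such that $\tau_{n-1},\tau_n,\tau_{n+1}$ are all non-zero at $t=0$, $$g_n^4=(2n+g_n)^2(g_n+g_{n-1})(g_n+g_{n+1}).$$ -/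

import Mathlib

open Filter Topology MeasureTheory

noncomputable section

/-- The unnormalised joint density of the `n` eigenvalues of the Gaussian unitary ensemble:
`exp (-∑ xⱼ²) ∏_{j<k} (xⱼ - xₖ)²`. -/
def gueWeight (n : ℕ) (x : Fin n → ℝ) : ℝ :=
  Real.exp (-∑ j, x j ^ 2) * ∏ j : Fin n, ∏ k ∈ Finset.Ioi j, (x j - x k) ^ 2

/-- The normalisation `N_n`, as an integral over `ℝⁿ`. -/
def gueNorm (n : ℕ) : ℝ := ∫ x : Fin n → ℝ, gueWeight n x

/-- `p(k, n)`: the probability that exactly `k` of the `n` eigenvalues are positive. -/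
def indexProb (k n : ℕ) : ℝ :=
  (gueNorm n)⁻¹ *
    ∫ x in {x : Fin n → ℝ | {j : Fin n | 0 < x j}.ncard = k}, gueWeight n x

/-- The generating function `Z_n(s) = ∑_{k=0}^n e^{-sk} p(k, n)` of the index. -/
def indexMGF (n : ℕ) (s : ℂ) : ℂ :=
  ∑ k ∈ Finset.range (n + 1), Complex.exp (-s * k) * (indexProb k n : ℂ)

/-- The moment `(∫_{-∞}^t + ξ ∫_t^∞) (t - x)^k e^{-x²} dx`. -/
def tauMoment (ξ : ℂ) (k : ℕ) (t : ℝ) : ℂ :=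
  ((∫ x in Set.Iic t, (t - x) ^ k * Real.exp (-x ^ 2) : ℝ) : ℂ)
    + ξ * ((∫ x in Set.Ioi t, (t - x) ^ k * Real.exp (-x ^ 2) : ℝ) : ℂ)

/-- The Hankel determinant `τ_n(t; 0; ξ)`, with the constant `C_n = 2^{n(n-1)}`. -/
def tau (ξ : ℂ) (n : ℕ) (t : ℝ) : ℂ :=
  2 ^ (n * (n - 1)) * (Matrix.of fun i j : Fin n => tauMoment ξ (i + j) t).det

/-- The Hamiltonian `½ f₀ f₁ f₂ + α₂ f₁ - α₁ f₂` of the symmetric form of the fourth Painlevé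
equation. -/
def hamiltonianPIV (α : Fin 3 → ℝ) (f : Fin 3 → ℝ → ℂ) (t : ℝ) : ℂ :=
  1 / 2 * f 0 t * f 1 t * f 2 t + α 2 * f 1 t - α 1 * f 2 t

/-- `(f₀, f₁, f₂)` is a meromorphic solution, in the real variable `t`, of the symmetric form of
the fourth Painlevé equation with parameters `α`. The differential equations and the constraint
are required outside a closed discrete set of `t`, which contains the poles. -/
structure IsSymmetricPIV (α : Fin 3 → ℝ) (f : Fin 3 → ℝ → ℂ) : Prop where
  param : α 0 + α 1 + α 2 = 1
  mero : ∀ i, Meromorphic (f i)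
  constraint : ∀ t₀ : ℝ, ∀ᶠ t in 𝓝[≠] t₀, f 0 t + f 1 t + f 2 t = 2 * t
  ode₀ : ∀ t₀ : ℝ, ∀ᶠ t in 𝓝[≠] t₀,
    HasDerivAt (f 0) (f 0 t * (f 1 t - f 2 t) + 2 * α 0) t
  ode₁ : ∀ t₀ : ℝ, ∀ᶠ t in 𝓝[≠] t₀,
    HasDerivAt (f 1) (f 1 t * (f 2 t - f 0 t) + 2 * α 1) t
  ode₂ : ∀ t₀ : ℝ, ∀ᶠ t in 𝓝[≠] t₀,
    HasDerivAt (f 2) (f 2 t * (f 0 t - f 1 t) + 2 * α 2) t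

/-- `f` solves the symmetric form of the fourth Painlevé equation with parameters `α`, and `τ` is
a `τ`-function of this solution: `H = d/dt log τ`, that is `τ' = H τ` with `τ ≠ 0`, outside a closed
discrete set. -/
structure IsTauFunctionOf (α : Fin 3 → ℝ) (f : Fin 3 → ℝ → ℂ) (τ : ℝ → ℂ) : Prop where
  sol : IsSymmetricPIV α f
  ne_zero : ∀ t₀ : ℝ, ∀ᶠ t in 𝓝[≠] t₀, τ t ≠ 0
  log_deriv : ∀ t₀ : ℝ, ∀ᶠ t in 𝓝[≠] t₀, HasDerivAt τ (hamiltonianPIV α f t * τ t) t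

/-- The parameters `(α₀ + n, α₁, -n)`. -/
def paramPIV (α₀ α₁ : ℝ) (n : ℕ) : Fin 3 → ℝ := ![α₀ + n, α₁, -n]

/-- `τ₀, τ₁, …` is a classical `τ`-function sequence of the fourth Painlevé equation starting on
the wall `α₂ = 0`: `τ₀ = 1`, each `τ_n` is a `τ`-function with parameters `(α₀ + n, α₁, -n)`, and
the Toda lattice equation `(log (e^{n t²} τ_n))'' = τ_{n+1} τ_{n-1} / τ_n²` holds. -/
structure IsClassicalTauSequence (α₀ α₁ : ℝ) (τ : ℕ → ℝ → ℂ) : Prop where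
  zero : ∀ t, τ 0 t = 1
  painleve : ∀ n, ∃ f : Fin 3 → ℝ → ℂ, IsTauFunctionOf (paramPIV α₀ α₁ n) f (τ n)
  smooth : ∀ n, ContDiff ℝ 2 (τ n)
  toda : ∀ n, 1 ≤ n → ∀ t, τ n t ≠ 0 →
    deriv (logDeriv fun u : ℝ => Complex.exp (n * u ^ 2) * τ n u) t
      = τ (n + 1) t * τ (n - 1) t / τ n t ^ 2

end

/-! Substituting y = t - x turns e^{t²} times the k-th moment μ_k into ∫ y^k e^{-y²+2ty} dy, cut at
the fixed point 0, with weight ξ on y < 0. Hence φ_k = 2^k e^{t²} μ_k satisfies φ_k' = φ_{k+1}, the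
function e^{nt²} τ_n is the Hankel determinant of the φ_{i+j}, and Toda is the Desnanot–Jacobi
identity (`hankelDet_toda`, `deriv_logDeriv_tau`).

The Painlevé property follows by induction on n (`IsTauLevel.next`) from a Riccati solution with f₂
= 0. The invariant is f₁ = (log τ_n/τ_{n+1})'. Since H' = f₁f₂, it gives (log τ_{n+1})'' = f₀f₁, so
Toda reads f₀f₁ + 2(n+1) = τ_{n+2}τ_n/τ_{n+1}². The logarithmic derivative of this shows that the
Bäcklund transform of f₁ is (log τ_{n+1}/τ_{n+2})' (`IsTauLevel.sq_mul_eq`).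

Put g_n = (log τ_n)'' and u_n = (log τ_n/τ_{n+1})'. Eliminating f leaves g_n + g_{n+1} = u_n(2t -
u_n) and g_{n+1}² = (g_{n+1} + 2(n+1)) u_n u_{n+1}. At t = 0 the first right side is -u_n², so
squaring the second gives `index_recurrence`. Toda converts it into the relation between five τ's
when none vanishes, in particular for ξ > 0; analyticity in ξ extends it to all ξ.

Random matrices enter through Andréief's identity for a Gaussian weight with jump ξ at 0, whose
n-fold product carries ξ to the number of positive eigenvalues (`sum_pow_mul_setIntegral`). At ξ = 1
the τ_n are constants fixed by Toda, which gives N_n; positivity of the density gives τ_n ≠ 0 for ξ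
> 0. -/

noncomputable section

/-! ### Gaussian half-line moments and their derivatives -/

open ProbabilityTheory in
/-- Translating a Gaussian half-line moment to the origin. -/
theorem exp_sq_mul_setIntegral_sub_pow (A : Set ℝ) (hA : MeasurableSet A) (k : ℕ) (t : ℝ) :
    Real.exp (t ^ 2) * ∫ x in {x | t - x ∈ A}, (t - x) ^ k * Real.exp (-x ^ 2) =
      √Real.pi * ∫ y, y ^ k * Real.exp (2 * t * y) ∂((gaussianReal 0 (1 / 2)).restrict A) := by
  have h1 : ∫ x in {x | t - x ∈ A}, (t - x) ^ k * Real.exp (-x ^ 2) =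
      ∫ x, A.indicator (fun y => y ^ k * Real.exp (-(t - y) ^ 2)) x := by
    rw [← integral_sub_left_eq_self _ volume t, ← integral_indicator (by
      exact (measurable_const.sub measurable_id) hA)]
    congr 1 with x
    by_cases hx : t - x ∈ A
    · simp [Set.indicator, hx]
    · simp [Set.indicator, hx]
  rw [h1, ← integral_indicator hA, integral_gaussianReal_eq_integral_smul (by norm_num),
    ← integral_const_mul, ← integral_const_mul]
  congr 1 with y
  by_cases hy : y ∈ A
  · have hpi : √Real.pi ≠ 0 := by positivity
    simp only [Set.indicator, hy, if_true, gaussianPDFReal, smul_eq_mul]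
    have e1 : Real.exp (t ^ 2) * (y ^ k * Real.exp (-(t - y) ^ 2)) =
        y ^ k * (Real.exp (t ^ 2) * Real.exp (-(t - y) ^ 2)) := by ring
    have e2 : (2 * Real.pi * ((1 / 2 : NNReal) : ℝ)) = Real.pi := by push_cast; ring
    have e3 : -(y - 0) ^ 2 / (2 * ((1 / 2 : NNReal) : ℝ)) = -y ^ 2 := by push_cast; ring
    rw [e1, e2, e3, ← Real.exp_add]
    have e4 : √Real.pi * ((√Real.pi)⁻¹ * Real.exp (-y ^ 2) * (y ^ k * Real.exp (2 * t * y))) =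
        y ^ k * (Real.exp (-y ^ 2) * Real.exp (2 * t * y)) := by field_simp
    rw [e4, ← Real.exp_add]
    ring_nf
  · simp [Set.indicator, hy]

open ProbabilityTheory in
theorem interior_integrableExpSet_gaussianReal_restrict (A : Set ℝ) :
    interior (integrableExpSet id ((gaussianReal 0 (1 / 2)).restrict A)) = Set.univ := by
  have : integrableExpSet id ((gaussianReal 0 (1 / 2)).restrict A) = Set.univ := by
    ext t
    have h : t ∈ integrableExpSet id (gaussianReal 0 (1 / 2)) := by
      rw [integrableExpSet_id_gaussianReal]; trivial
    simpa [integrableExpSet] using Integrable.restrict (s := A) (show Integrable _ _ from h)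
  rw [this, interior_univ]

/-- `2^k e^{t²} ∫_{t - x ∈ A} (t - x)^k e^{-x²} dx`. -/
def scaledHalfMoment (A : Set ℝ) (k : ℕ) (t : ℝ) : ℝ :=
  2 ^ k * (Real.exp (t ^ 2) * ∫ x in {x | t - x ∈ A}, (t - x) ^ k * Real.exp (-x ^ 2))

-- Differentiating e^{2ty} produces 2y; the 2 is what the factor 2^k absorbs.
open ProbabilityTheory in
theorem hasDerivAt_scaledHalfMoment {A : Set ℝ} (hA : MeasurableSet A) (k : ℕ) (t : ℝ) :
    HasDerivAt (scaledHalfMoment A k) (scaledHalfMoment A (k + 1) t) t := by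
  have h := hasDerivAt_integral_pow_mul_exp_real (X := id)
    (μ := (gaussianReal 0 (1 / 2)).restrict A) (t := 2 * t)
    (by rw [interior_integrableExpSet_gaussianReal_restrict]; trivial) k
  have h2 := (h.comp t ((hasDerivAt_id t).const_mul 2)).const_mul (2 ^ k * √Real.pi)
  have e : ∀ k, scaledHalfMoment A k = fun t => 2 ^ k * √Real.pi *
      ∫ y, y ^ k * Real.exp (2 * t * y) ∂((gaussianReal 0 (1 / 2)).restrict A) := by
    intro k; ext t; rw [scaledHalfMoment, exp_sq_mul_setIntegral_sub_pow A hA]; ring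
  rw [e, e]
  convert! h2 using 1
  simp only [id]; ring

-- A restricted Gaussian has all exponential moments, so its moment generating function is analytic
-- on the whole line.
open ProbabilityTheory in
theorem analyticAt_scaledHalfMoment {A : Set ℝ} (hA : MeasurableSet A) (k : ℕ) (t : ℝ) :
    AnalyticAt ℝ (scaledHalfMoment A k) t := by
  have hI : ∀ s : ℝ, s ∈ interior (integrableExpSet id ((gaussianReal 0 (1 / 2)).restrict A)) := by
    intro s; rw [interior_integrableExpSet_gaussianReal_restrict]; trivial
  have e : scaledHalfMoment A k = fun t => 2 ^ k * √Real.pi *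
      iteratedDeriv k (mgf id ((gaussianReal 0 (1 / 2)).restrict A)) (2 * t) := by
    ext t; rw [iteratedDeriv_mgf (hI _), scaledHalfMoment, exp_sq_mul_setIntegral_sub_pow A hA]
    simp only [id]; ring
  rw [e]
  have h2 : AnalyticAt ℝ (fun t : ℝ => 2 * t) t := analyticAt_const.mul analyticAt_id
  exact analyticAt_const.mul ((analyticAt_iteratedDeriv_mgf (hI (2 * t)) k).comp_of_eq h2 rfl)

/-- `φ_k(t) = 2^k e^{t²} μ_k(t)`, with `μ_k` the moment `tauMoment`; these are the successive
derivatives of `φ_0`. -/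
def scaledMoment (ξ : ℂ) (k : ℕ) (t : ℝ) : ℂ :=
  2 ^ k * Complex.exp (t ^ 2) * tauMoment ξ k t

theorem scaledMoment_eq (ξ : ℂ) (k : ℕ) : scaledMoment ξ k = fun t : ℝ =>
    (scaledHalfMoment (Set.Ici 0) k t : ℂ) + ξ * (scaledHalfMoment (Set.Iio 0) k t : ℂ) := by
  ext t
  have h1 : {x : ℝ | t - x ∈ Set.Ici 0} = Set.Iic t := by ext x; simp
  have h2 : {x : ℝ | t - x ∈ Set.Iio 0} = Set.Ioi t := by ext x; simp
  rw [scaledMoment, scaledHalfMoment, scaledHalfMoment, tauMoment, h1, h2]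
  push_cast
  ring

theorem hasDerivAt_scaledMoment (ξ : ℂ) (k : ℕ) (t : ℝ) :
    HasDerivAt (scaledMoment ξ k) (scaledMoment ξ (k + 1) t) t := by
  rw [scaledMoment_eq, scaledMoment_eq]
  exact (hasDerivAt_scaledHalfMoment measurableSet_Ici k t).ofReal_comp.add
    ((hasDerivAt_scaledHalfMoment measurableSet_Iio k t).ofReal_comp.const_mul ξ)

theorem AnalyticAt.complex_ofReal {f : ℝ → ℝ} {t : ℝ} (hf : AnalyticAt ℝ f t) :
    AnalyticAt ℝ (fun s => (f s : ℂ)) t :=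
  (Complex.ofRealCLM.analyticAt (f t)).comp hf

theorem analyticAt_scaledMoment (ξ : ℂ) (k : ℕ) (t : ℝ) :
    AnalyticAt ℝ (scaledMoment ξ k) t := by
  rw [scaledMoment_eq]
  exact (analyticAt_scaledHalfMoment measurableSet_Ici k t).complex_ofReal.add
    (analyticAt_const.mul (analyticAt_scaledHalfMoment measurableSet_Iio k t).complex_ofReal)

theorem integrable_exp_neg_sq : Integrable (fun x : ℝ => Real.exp (-x ^ 2)) := by
  simpa using integrable_exp_neg_mul_sq (one_pos : (0 : ℝ) < 1)

theorem hasDerivAt_tauMoment_zero (ξ : ℂ) (t : ℝ) :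
    HasDerivAt (tauMoment ξ 0) ((1 - ξ) * Complex.exp (-t ^ 2)) t := by
  have hI := integrable_exp_neg_sq
  have hc : Continuous (fun x : ℝ => Real.exp (-x ^ 2)) := by fun_prop
  have hd : HasDerivAt (fun t => ∫ x in (0 : ℝ)..t, Real.exp (-x ^ 2)) (Real.exp (-t ^ 2)) t :=
    hc.integral_hasStrictDerivAt 0 t |>.hasDerivAt
  have e1 : ∀ t, ∫ x in Set.Iic t, Real.exp (-x ^ 2) =
      (∫ x in Set.Iic (0 : ℝ), Real.exp (-x ^ 2)) + ∫ x in (0 : ℝ)..t, Real.exp (-x ^ 2) := by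
    intro t
    rw [← intervalIntegral.integral_Iic_sub_Iic hI.integrableOn hI.integrableOn]; ring
  have e2 : ∀ t, ∫ x in Set.Ioi t, Real.exp (-x ^ 2) = (∫ x, Real.exp (-x ^ 2)) -
      ((∫ x in Set.Iic (0 : ℝ), Real.exp (-x ^ 2)) + ∫ x in (0 : ℝ)..t, Real.exp (-x ^ 2)) := by
    intro t
    rw [← e1, ← integral_add_compl (measurableSet_Iic (a := t)) hI, Set.compl_Iic]; ring
  have e : tauMoment ξ 0 = fun t : ℝ =>
      (((∫ x in Set.Iic (0 : ℝ), Real.exp (-x ^ 2)) + ∫ x in (0 : ℝ)..t, Real.exp (-x ^ 2) : ℝ) : ℂ)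
      + ξ * (((∫ x, Real.exp (-x ^ 2)) - ((∫ x in Set.Iic (0 : ℝ), Real.exp (-x ^ 2)) +
        ∫ x in (0 : ℝ)..t, Real.exp (-x ^ 2)) : ℝ) : ℂ) := by
    ext t
    rw [← e2, ← e1]; simp [tauMoment]
  rw [e]
  convert! (hd.const_add (∫ x in Set.Iic (0 : ℝ), Real.exp (-x ^ 2))).ofReal_comp.add
    (((hd.const_add (∫ x in Set.Iic (0 : ℝ), Real.exp (-x ^ 2))).const_sub
      (∫ x, Real.exp (-x ^ 2))).ofReal_comp.const_mul ξ) using 1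
  push_cast; ring

theorem tauMoment_one_zero (t : ℝ) : tauMoment 1 0 t = (√Real.pi : ℂ) := by
  have hI := integrable_exp_neg_sq
  have h := integral_add_compl (measurableSet_Iic (a := t)) hI
  have h2 := integral_gaussian 1
  simp only [tauMoment, pow_zero, one_mul]
  rw [Set.compl_Iic] at h
  rw [← Complex.ofReal_add, h]
  simp only [neg_mul, one_mul, div_one] at h2
  rw [h2]

/-! ### The Desnanot–Jacobi identity -/

/-- The matrix `A` bordered by the `a`-th row of `C` and the `b`-th column of `B`. -/
def Matrix.bordered {m p : ℕ} (A : Matrix (Fin m) (Fin m) ℂ) (B : Matrix (Fin m) (Fin p) ℂ)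
    (C : Matrix (Fin p) (Fin m) ℂ) (D : Matrix (Fin p) (Fin p) ℂ) (a b : Fin p) :
    Matrix (Fin m ⊕ Fin 1) (Fin m ⊕ Fin 1) ℂ :=
  Matrix.fromBlocks A (B.submatrix id fun _ => b) (C.submatrix (fun _ => a) id)
    (D.submatrix (fun _ => a) fun _ => b)

theorem Matrix.det_bordered_of_det_ne_zero {m p : ℕ} {A : Matrix (Fin m) (Fin m) ℂ}
    (B : Matrix (Fin m) (Fin p) ℂ) (C : Matrix (Fin p) (Fin m) ℂ) (D : Matrix (Fin p) (Fin p) ℂ)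
    (hA : A.det ≠ 0) (a b : Fin p) :
    (Matrix.bordered A B C D a b).det = A.det * (D - C * A⁻¹ * B) a b := by
  have : Invertible A := Matrix.invertibleOfIsUnitDet A (isUnit_iff_ne_zero.2 hA)
  rw [Matrix.bordered, Matrix.det_fromBlocks₁₁, Matrix.det_unique (n := Fin 1),
    Matrix.invOf_eq_nonsing_inv]
  rfl

theorem Matrix.eventually_det_add_smul_one_ne_zero {m : ℕ} (A : Matrix (Fin m) (Fin m) ℂ) :
    ∀ᶠ ε : ℂ in 𝓝[≠] 0, (A + ε • (1 : Matrix (Fin m) (Fin m) ℂ)).det ≠ 0 := by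
  have h : ∀ ε : ℂ, (A + ε • (1 : Matrix (Fin m) (Fin m) ℂ)).det = (-A).charpoly.eval ε := by
    intro ε
    rw [Matrix.eval_charpoly, sub_neg_eq_add, add_comm, Matrix.smul_one_eq_diagonal]
    rfl
  have hfin : {ε : ℂ | (-A).charpoly.IsRoot ε}.Finite :=
    Polynomial.finite_setOfPred_isRoot (Matrix.charpoly_monic (-A)).ne_zero
  have h0 := (hfin.subset (Set.sdiff_subset (t := {0}))).isClosed.isOpen_compl.mem_nhds
    (show (0 : ℂ) ∈ ({ε : ℂ | (-A).charpoly.IsRoot ε} \ {0})ᶜ by simp)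
  filter_upwards [nhdsWithin_le_nhds h0, self_mem_nhdsWithin] with ε h1 h2 h3
  exact h1 ⟨by rw [h] at h3; exact h3, h2⟩

/-- The Desnanot–Jacobi identity. -/
theorem Matrix.det_fromBlocks_mul_det {m : ℕ} (A : Matrix (Fin m) (Fin m) ℂ)
    (B : Matrix (Fin m) (Fin 2) ℂ) (C : Matrix (Fin 2) (Fin m) ℂ) (D : Matrix (Fin 2) (Fin 2) ℂ) :
    (Matrix.fromBlocks A B C D).det * A.det =
      (bordered A B C D 0 0).det * (bordered A B C D 1 1).det -
        (bordered A B C D 0 1).det * (bordered A B C D 1 0).det := by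
  have key : ∀ A : Matrix (Fin m) (Fin m) ℂ, A.det ≠ 0 →
      (Matrix.fromBlocks A B C D).det * A.det =
      (bordered A B C D 0 0).det * (bordered A B C D 1 1).det -
        (bordered A B C D 0 1).det * (bordered A B C D 1 0).det := by
    intro A hA
    have : Invertible A := Matrix.invertibleOfIsUnitDet A (isUnit_iff_ne_zero.2 hA)
    simp only [det_bordered_of_det_ne_zero B C D hA]
    rw [Matrix.det_fromBlocks₁₁, Matrix.det_fin_two, Matrix.invOf_eq_nonsing_inv]
    ring
  -- The Schur complement needs A invertible. A singular A is the limit of A + ε, which is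
  -- invertible for small ε ≠ 0, and both sides are continuous in ε.
  have hA : Continuous fun ε : ℂ => A + ε • (1 : Matrix (Fin m) (Fin m) ℂ) := by fun_prop
  have hb : ∀ a b, Continuous fun ε : ℂ =>
      (bordered (A + ε • (1 : Matrix (Fin m) (Fin m) ℂ)) B C D a b).det := fun a b =>
    (hA.matrix_fromBlocks continuous_const continuous_const continuous_const).matrix_det
  have hl : Continuous fun ε : ℂ =>
      (Matrix.fromBlocks (A + ε • (1 : Matrix (Fin m) (Fin m) ℂ)) B C D).det *
        (A + ε • (1 : Matrix (Fin m) (Fin m) ℂ)).det :=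
    (hA.matrix_fromBlocks continuous_const continuous_const continuous_const).matrix_det.mul
      hA.matrix_det
  have hr := ((hb 0 0).mul (hb 1 1)).sub ((hb 0 1).mul (hb 1 0))
  have := tendsto_nhds_unique_of_eventuallyEq
    ((hl.tendsto 0).mono_left (nhdsWithin_le_nhds (s := {0}ᶜ)))
    ((hr.tendsto 0).mono_left nhdsWithin_le_nhds)
    ((eventually_det_add_smul_one_ne_zero A).mono fun ε hε => key _ hε)
  simpa using this

/-! ### Hankel determinants and the Toda equation -/

/-- The exponents `0, 1, …, m - 1, m + a`. -/
def lastShift (m a : ℕ) (i : Fin (m + 1)) : ℕ := if (i : ℕ) = m then m + a else i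

/-- The determinant of `φ_{r i + c j}`. -/
def hankelMinor (φ : ℕ → ℝ → ℂ) {n : ℕ} (r c : Fin n → ℕ) (t : ℝ) : ℂ :=
  (Matrix.of fun i j => φ (r i + c j) t).det

theorem hankelMinor_comm (φ : ℕ → ℝ → ℂ) {n : ℕ} (r c : Fin n → ℕ) :
    hankelMinor φ r c = hankelMinor φ c r := by
  ext t
  rw [hankelMinor, hankelMinor, ← Matrix.det_transpose]
  congr 1; ext i j; simp [add_comm]

/-- Differentiating a row shifts its index by one. For every row but the last this duplicates the
next row, so only the last row contributes. -/
theorem hasDerivAt_hankelMinor {φ : ℕ → ℝ → ℂ} (hφ : ∀ k t, HasDerivAt (φ k) (φ (k + 1) t) t)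
    {m : ℕ} (c : Fin (m + 1) → ℕ) (t : ℝ) :
    HasDerivAt (hankelMinor φ (lastShift m 0) c) (hankelMinor φ (lastShift m 1) c t) t := by
  let F : ContinuousMultilinearMap ℝ (fun _ : Fin (m + 1) => Fin (m + 1) → ℂ) ℂ :=
    { ((Matrix.detRowAlternating (n := Fin (m + 1)) (R := ℂ)).toMultilinearMap.restrictScalars ℝ)
      with cont := Continuous.matrix_det continuous_id }
  have hF : ∀ M : Matrix (Fin (m + 1)) (Fin (m + 1)) ℂ, F M = M.det := fun M => rfl
  let M : ℝ → Fin (m + 1) → Fin (m + 1) → ℂ := fun t i j => φ (lastShift m 0 i + c j) t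
  have hM : HasDerivAt M (fun i j => φ (lastShift m 0 i + c j + 1) t) t := by
    rw [hasDerivAt_pi]; intro i; rw [hasDerivAt_pi]; intro j; exact hφ _ t
  have h := (F.hasFDerivAt (M t)).comp_hasDerivAt t hM
  rw [ContinuousMultilinearMap.linearDeriv_apply, Finset.sum_eq_single (Fin.last m)] at h
  · convert! h using 1
    rw [hankelMinor, ← hF]
    congr 1
    ext i j
    by_cases hi : i = Fin.last m
    · subst hi
      simp only [lastShift, Function.update_self, Matrix.of_apply, Fin.val_last, if_true]
      ring_nf
    · have : (i : ℕ) ≠ m := fun h => hi (Fin.ext h)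
      simp [Function.update_of_ne hi, M, lastShift, this]
  · intro k _ hk
    have hk' : (k : ℕ) ≠ m := fun h => hk (Fin.ext h)
    have hlt : (k : ℕ) + 1 < m + 1 := by omega
    have hne : k ≠ ⟨k + 1, hlt⟩ := by intro h; simp [Fin.ext_iff] at h
    refine (hF _).trans (Matrix.det_zero_of_row_eq hne ?_)
    ext j
    rw [Function.update_self, Function.update_of_ne hne.symm]
    simp only [M, lastShift, hk', if_false]
    split_ifs with h
    · exact congrArg (fun k => φ k t) (by omega)
    · exact congrArg (fun k => φ k t) (by omega)
  · simp

theorem det_finSum {m p : ℕ} (f : ℕ → ℕ → ℂ) (r c : Fin (m + p) → ℕ) :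
    (Matrix.of fun i j => f (r i) (c j)).det = (Matrix.fromBlocks
      (Matrix.of fun i j : Fin m => f (r (Fin.castAdd p i)) (c (Fin.castAdd p j)))
      (Matrix.of fun (i : Fin m) (j : Fin p) => f (r (Fin.castAdd p i)) (c (Fin.natAdd m j)))
      (Matrix.of fun (i : Fin p) (j : Fin m) => f (r (Fin.natAdd m i)) (c (Fin.castAdd p j)))
      (Matrix.of fun i j : Fin p => f (r (Fin.natAdd m i)) (c (Fin.natAdd m j)))).det := by
  rw [← Matrix.det_submatrix_equiv_self finSumFinEquiv]
  congr 1
  ext i j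
  rcases i with i | i <;> rcases j with j | j <;> simp

/-- Desnanot–Jacobi with the leading m × m block as pivot; the two mixed minors are equal by the
symmetry of Hankel matrices. -/
theorem hankelMinor_toda (φ : ℕ → ℝ → ℂ) (m : ℕ) (t : ℝ) :
    hankelMinor φ (fun i : Fin (m + 2) => (i : ℕ)) (fun i => i) t *
        hankelMinor φ (fun i : Fin m => (i : ℕ)) (fun i => i) t =
      hankelMinor φ (lastShift m 0) (lastShift m 0) t *
          hankelMinor φ (lastShift m 1) (lastShift m 1) t -
        hankelMinor φ (lastShift m 1) (lastShift m 0) t ^ 2 := by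
  have hJ := Matrix.det_fromBlocks_mul_det
    (Matrix.of fun i j : Fin m => φ (i + j) t)
    (Matrix.of fun (i : Fin m) (j : Fin 2) => φ (i + (m + j)) t)
    (Matrix.of fun (i : Fin 2) (j : Fin m) => φ (m + i + j) t)
    (Matrix.of fun i j : Fin 2 => φ (m + i + (m + j)) t)
  have hb : ∀ a b : Fin 2, (Matrix.bordered
      (Matrix.of fun i j : Fin m => φ (i + j) t)
      (Matrix.of fun (i : Fin m) (j : Fin 2) => φ (i + (m + j)) t)
      (Matrix.of fun (i : Fin 2) (j : Fin m) => φ (m + i + j) t)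
      (Matrix.of fun i j : Fin 2 => φ (m + i + (m + j)) t) a b).det =
      hankelMinor φ (lastShift m a) (lastShift m b) t := by
    intro a b
    rw [hankelMinor, det_finSum (fun i j => φ (i + j) t), Matrix.bordered]
    congr 1
    have hlt : ∀ i : Fin m, (i : ℕ) ≠ m := fun i => i.2.ne
    ext i j
    rcases i with i | i <;> rcases j with j | j <;> simp [lastShift, hlt]
  rw [hb, hb, hb, hb] at hJ
  have h2 : hankelMinor φ (fun i : Fin (m + 2) => (i : ℕ)) (fun i => i) t = _ :=
    det_finSum (fun i j => φ (i + j) t) _ _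
  rw [h2]
  simp only [Fin.val_castAdd, Fin.val_natAdd] 
  rw [hankelMinor, hJ]
  simp only [Fin.val_zero, Fin.val_one, sq]
  rw [hankelMinor_comm φ (lastShift m 0) (lastShift m 1)]

theorem lastShift_zero (m : ℕ) : lastShift m 0 = fun i : Fin (m + 1) => (i : ℕ) := by
  ext i; simp only [lastShift]; split_ifs with h <;> omega

/-- The Hankel determinant of `φ_{i+j}`. -/
def hankelDet (φ : ℕ → ℝ → ℂ) (n : ℕ) : ℝ → ℂ :=
  hankelMinor φ (fun i : Fin n => (i : ℕ)) fun i => i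

/-- The Toda equation for the Hankel determinants of the successive derivatives of a function. -/
theorem hankelDet_toda {φ : ℕ → ℝ → ℂ} (hφ : ∀ k t, HasDerivAt (φ k) (φ (k + 1) t) t) (m : ℕ)
    (t : ℝ) :
    hankelDet φ (m + 2) t * hankelDet φ m t =
      hankelDet φ (m + 1) t * deriv (deriv (hankelDet φ (m + 1))) t -
        deriv (hankelDet φ (m + 1)) t ^ 2 := by
  have e : hankelDet φ (m + 1) = hankelMinor φ (lastShift m 0) (lastShift m 0) := by
    rw [hankelDet, lastShift_zero]
  have h1 : deriv (hankelDet φ (m + 1)) = hankelMinor φ (lastShift m 0) (lastShift m 1) := by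
    ext s; rw [e, (hasDerivAt_hankelMinor hφ _ s).deriv, hankelMinor_comm]
  rw [h1, (hasDerivAt_hankelMinor hφ _ t).deriv, hankelMinor_comm _ (lastShift m 0), e]
  exact hankelMinor_toda φ m t

theorem analyticAt_hankelDet {φ : ℕ → ℝ → ℂ} {t : ℝ} (hφ : ∀ k, AnalyticAt ℝ (φ k) t) (n : ℕ) :
    AnalyticAt ℝ (hankelDet φ n) t := by
  have e : hankelDet φ n = fun t => ∑ σ : Equiv.Perm (Fin n), ((Equiv.Perm.sign σ : ℤ) : ℂ) *
      ∏ i, φ (σ i + i) t := by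
    ext t; simp [hankelDet, hankelMinor, Matrix.det_apply']
  rw [e]
  exact Finset.analyticAt_fun_sum _ fun σ _ => analyticAt_const.mul
    (Finset.analyticAt_fun_prod _ fun i _ => hφ _)

/-! ### The Toda equation for τ_n -/

theorem Matrix.det_of_smul_smul {n : ℕ} (M : Matrix (Fin n) (Fin n) ℂ) (v : Fin n → ℂ) :
    (Matrix.of fun i j => v i * v j * M i j).det = (∏ i, v i) ^ 2 * M.det := by
  have h : (Matrix.of fun i j => v i * v j * M i j) =
      Matrix.diagonal v * M * Matrix.diagonal v := by
    ext i j; simp [Matrix.mul_diagonal, Matrix.diagonal_mul]; ring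
  rw [h, Matrix.det_mul, Matrix.det_mul, Matrix.det_diagonal]; ring

/-- Row and column factors 2^i and 2^j account for the constant 2^{n(n-1)}, and one factor e^{t²}
per row for the exponential. -/
theorem hankelDet_scaledMoment (ξ : ℂ) (n : ℕ) (t : ℝ) :
    hankelDet (scaledMoment ξ) n t = Complex.exp (n * t ^ 2) * tau ξ n t := by
  have e : (Matrix.of fun i j : Fin n => scaledMoment ξ (i + j) t) =
      Complex.exp (t ^ 2) • (Matrix.of fun i j : Fin n =>
        (2 : ℂ) ^ (i : ℕ) * 2 ^ (j : ℕ) * (Matrix.of fun i j : Fin n => tauMoment ξ (i + j) t) i j) := by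
    ext i j; simp [scaledMoment, pow_add]; ring
  have hp : (∏ i : Fin n, (2 : ℂ) ^ (i : ℕ)) ^ 2 = 2 ^ (n * (n - 1)) := by
    rw [Finset.prod_pow_eq_pow_sum, ← pow_mul, Fin.sum_univ_eq_sum_range (fun i => i),
      Finset.sum_range_id_mul_two]
  rw [hankelDet, hankelMinor, e, Matrix.det_smul, Matrix.det_of_smul_smul, hp, tau,
    Complex.exp_nat_mul, Fintype.card_fin]

theorem analyticAt_exp_nat_mul_sq (n : ℕ) (t : ℝ) :
    AnalyticAt ℝ (fun t : ℝ => Complex.exp (n * (t : ℂ) ^ 2)) t := by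
  have h : AnalyticAt ℝ (fun t : ℝ => (n : ℝ) * t ^ 2) t :=
    analyticAt_const.mul (analyticAt_id.pow 2)
  have := ((analyticAt_rexp (x := (n : ℝ) * t ^ 2)).comp_of_eq h rfl).complex_ofReal
  simp only [Function.comp_def, Complex.ofReal_exp, Complex.ofReal_mul, Complex.ofReal_pow,
    Complex.ofReal_natCast] at this
  exact this

theorem analyticAt_tau (ξ : ℂ) (n : ℕ) (t : ℝ) : AnalyticAt ℝ (tau ξ n) t := by
  have e : tau ξ n = fun t : ℝ => (Complex.exp (n * (t : ℂ) ^ 2))⁻¹ * hankelDet (scaledMoment ξ) n t := by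
    ext t; rw [hankelDet_scaledMoment, inv_mul_cancel_left₀ (Complex.exp_ne_zero _)]
  rw [e]
  exact ((analyticAt_exp_nat_mul_sq n t).inv (Complex.exp_ne_zero _)).mul
    (analyticAt_hankelDet (fun k => analyticAt_scaledMoment ξ k t) n)

/-- The Toda equation for `τ_n`. -/
theorem deriv_logDeriv_tau {ξ : ℂ} {n : ℕ} {t : ℝ} (ht : tau ξ (n + 1) t ≠ 0) :
    deriv (logDeriv (tau ξ (n + 1))) t + 2 * (n + 1) =
      tau ξ (n + 2) t * tau ξ n t / tau ξ (n + 1) t ^ 2 ∧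
    deriv (logDeriv fun u : ℝ => Complex.exp ((n + 1 : ℕ) * (u : ℂ) ^ 2) * tau ξ (n + 1) u) t =
      tau ξ (n + 2) t * tau ξ n t / tau ξ (n + 1) t ^ 2 := by
  set D := hankelDet (scaledMoment ξ) (n + 1) with hD
  have eD : (fun u : ℝ => Complex.exp ((n + 1 : ℕ) * (u : ℂ) ^ 2) * tau ξ (n + 1) u) = D := by
    ext u; rw [hD, hankelDet_scaledMoment]
  have hDan : ∀ t, AnalyticAt ℝ D t := fun t =>
    analyticAt_hankelDet (fun k => analyticAt_scaledMoment ξ k t) _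
  have hDt : D t ≠ 0 := by
    rw [hD, hankelDet_scaledMoment]; exact mul_ne_zero (Complex.exp_ne_zero _) ht
  have h2 : deriv (logDeriv D) t = tau ξ (n + 2) t * tau ξ n t / tau ξ (n + 1) t ^ 2 := by
    have : deriv (logDeriv D) t =
        (deriv (deriv D) t * D t - deriv D t * deriv D t) / D t ^ 2 :=
      deriv_div (hDan t).deriv.differentiableAt (hDan t).differentiableAt hDt
    have hT := hankelDet_toda (hasDerivAt_scaledMoment ξ) n t
    rw [← hD] at hT
    rw [this, show deriv (deriv D) t * D t - deriv D t * deriv D t =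
      D t * deriv (deriv D) t - deriv D t ^ 2 by ring, ← hT, hD]
    simp only [hankelDet_scaledMoment]
    rw [div_eq_div_iff (by simpa [Complex.exp_ne_zero] using ht) (by simpa using ht)]
    -- The exponentials cancel because (n + 2) + n = 2(n + 1).
    have hexp : Complex.exp ((n + 2 : ℕ) * (t : ℂ) ^ 2) * Complex.exp (n * (t : ℂ) ^ 2) =
        Complex.exp ((n + 1 : ℕ) * (t : ℂ) ^ 2) ^ 2 := by
      rw [← Complex.exp_add, ← Complex.exp_nat_mul]; push_cast; ring_nf
    rw [mul_pow, ← hexp]; ring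
  refine ⟨?_, by rw [eD]; exact h2⟩
  rw [← h2, ← eD]
  have hne : ∀ᶠ u in 𝓝 t, tau ξ (n + 1) u ≠ 0 :=
    (analyticAt_tau ξ (n + 1) t).continuousAt.eventually_ne ht
  have hE : ∀ u : ℝ, HasDerivAt (fun u : ℝ => Complex.exp ((n + 1 : ℕ) * (u : ℂ) ^ 2))
      (Complex.exp ((n + 1 : ℕ) * (u : ℂ) ^ 2) * (2 * (n + 1) * u)) u := by
    intro u
    have h1 : HasDerivAt (fun u : ℝ => ((n + 1 : ℕ) : ℂ) * (u : ℂ) ^ 2)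
        (2 * (n + 1) * u) u := by
      convert! ((Complex.ofRealCLM.hasDerivAt (x := u)).pow 2).const_mul ((n + 1 : ℕ) : ℂ) using 1
      simp; ring
    exact h1.cexp
  have hlog : (logDeriv fun u : ℝ => Complex.exp ((n + 1 : ℕ) * (u : ℂ) ^ 2) * tau ξ (n + 1) u)
      =ᶠ[𝓝 t] fun u => logDeriv (tau ξ (n + 1)) u + 2 * (n + 1) * u := by
    filter_upwards [hne] with u hu
    rw [logDeriv_mul u (Complex.exp_ne_zero _) hu (hE u).differentiableAt
      (analyticAt_tau ξ (n + 1) u).differentiableAt, logDeriv_apply, (hE u).deriv]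
    field_simp [Complex.exp_ne_zero]
    ring
  rw [hlog.deriv_eq]
  have hl : DifferentiableAt ℝ (logDeriv (tau ξ (n + 1))) t :=
    ((analyticAt_tau ξ (n + 1) t).deriv.div (analyticAt_tau ξ (n + 1) t) ht).differentiableAt
  have hlin : HasDerivAt (fun u : ℝ => 2 * ((n : ℂ) + 1) * (u : ℂ)) (2 * (n + 1)) t := by
    simpa using (Complex.ofRealCLM.hasDerivAt (x := t)).const_mul (2 * ((n : ℂ) + 1))
  exact ((hl.hasDerivAt.add hlin).deriv).symm

/-! ### Generic points and meromorphic functions -/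

theorem eventually_codiscrete_iff {P : ℝ → Prop} :
    (∀ᶠ t in codiscrete ℝ, P t) ↔ ∀ t₀ : ℝ, ∀ᶠ t in 𝓝[≠] t₀, P t := by
  rw [Filter.Eventually, mem_codiscrete]
  simp only [disjoint_principal_right, compl_compl]
  rfl

/-- This permits differentiating an identity that is known only at generic points. -/
theorem eventually_codiscrete_nhds {P : ℝ → Prop} (h : ∀ᶠ t in codiscrete ℝ, P t) :
    ∀ᶠ t in codiscrete ℝ, ∀ᶠ s in 𝓝 t, P s := by
  rw [eventually_codiscrete_iff] at h ⊢
  intro t₀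
  filter_upwards [eventually_eventually_nhdsWithin.2 (h t₀), self_mem_nhdsWithin] with t h1 h2
  rwa [isOpen_compl_singleton.nhdsWithin_eq h2] at h1

theorem Meromorphic.eventually_codiscrete_ne_zero {f : ℝ → ℂ} (hf : Meromorphic f)
    (h : ∀ᶠ t in codiscrete ℝ, ¬ ∀ᶠ s in 𝓝 t, f s = 0) : ∀ᶠ t in codiscrete ℝ, f t ≠ 0 := by
  rw [eventually_codiscrete_iff] at h ⊢
  intro t₀
  refine (hf t₀).eventually_eq_zero_or_eventually_ne_zero.resolve_left fun h0 => ?_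
  have h1 : ∀ᶠ t in 𝓝[≠] t₀, ∀ᶠ s in 𝓝 t, f s = 0 := by
    filter_upwards [eventually_eventually_nhdsWithin.2 h0, self_mem_nhdsWithin] with t h1 h2
    rwa [isOpen_compl_singleton.nhdsWithin_eq h2] at h1
  obtain ⟨t, ht⟩ := ((h t₀).and h1).exists
  exact ht.1 ht.2

/-! ### Bäcklund transformation of the symmetric Painlevé system -/

/-- The equations for a `τ`-function with parameters `(1 + n, 0, -n)` at a generic point. -/
theorem IsTauFunctionOf.generic {n : ℕ} {f : Fin 3 → ℝ → ℂ} {τ : ℝ → ℂ}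
    (h : IsTauFunctionOf (paramPIV 1 0 n) f τ) : ∀ᶠ t in codiscrete ℝ,
      f 2 t = 2 * t - f 0 t - f 1 t ∧
      HasDerivAt (f 0) (f 0 t * (f 1 t - f 2 t) + 2 * (n + 1)) t ∧
      HasDerivAt (f 1) (f 1 t * (f 2 t - f 0 t)) t ∧
      HasDerivAt (f 2) (f 2 t * (f 0 t - f 1 t) - 2 * n) t ∧
      τ t ≠ 0 ∧ logDeriv τ t = 1 / 2 * f 0 t * f 1 t * f 2 t - n * f 1 t := by
  filter_upwards [eventually_codiscrete_iff.2 h.sol.constraint,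
    eventually_codiscrete_iff.2 h.sol.ode₀, eventually_codiscrete_iff.2 h.sol.ode₁,
    eventually_codiscrete_iff.2 h.sol.ode₂, eventually_codiscrete_iff.2 h.ne_zero,
    eventually_codiscrete_iff.2 h.log_deriv] with t h1 h2 h3 h4 h5 h6
  refine ⟨by rw [← h1]; ring, ?_, ?_, ?_, h5, ?_⟩
  · convert h2 using 2; simp [paramPIV]; ring
  · convert h3 using 1; simp [paramPIV]
  · convert h4 using 1; simp [paramPIV]; ring
  · rw [logDeriv_apply, h6.deriv, mul_div_cancel_right₀ _ h5]
    simp [hamiltonianPIV, paramPIV]; ring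

/-- The derivative of the Hamiltonian is `f₁ f₂`. -/
theorem IsTauFunctionOf.hasDerivAt_logDeriv {n : ℕ} {f : Fin 3 → ℝ → ℂ} {τ : ℝ → ℂ}
    (h : IsTauFunctionOf (paramPIV 1 0 n) f τ) : ∀ᶠ t in codiscrete ℝ,
      HasDerivAt (logDeriv τ) (f 1 t * f 2 t) t := by
  filter_upwards [h.generic, eventually_codiscrete_nhds h.generic] with t ⟨_, h0, h1, h2, _, _⟩ hn
  have e : logDeriv τ =ᶠ[𝓝 t] fun t => 1 / 2 * f 0 t * f 1 t * f 2 t - n * f 1 t :=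
    hn.mono fun s hs => hs.2.2.2.2.2
  refine HasDerivAt.congr_of_eventuallyEq ?_ e
  convert! (((h0.const_mul (1 / 2)).mul h1).mul h2).sub (h1.const_mul (n : ℂ)) using 1
  simp only [Pi.mul_apply]
  -- The cubic terms cancel cyclically, and the n f₀f₁ terms cancel between the two parts of H.
  ring

/-- The functions `f` solve the fourth Painlevé equation with `τ`-function `τ_n`, and
`f₁ = (log (τ_n / τ_{n+1}))'`. -/
structure IsTauLevel (ξ : ℂ) (n : ℕ) (f : Fin 3 → ℝ → ℂ) : Prop where
  isTau : IsTauFunctionOf (paramPIV 1 0 n) f (tau ξ n)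
  next_ne_zero : ∀ᶠ t in codiscrete ℝ, tau ξ (n + 1) t ≠ 0
  one_eq : ∀ᶠ t in codiscrete ℝ, f 1 t = logDeriv (tau ξ n) t - logDeriv (tau ξ (n + 1)) t

namespace IsTauLevel

variable {ξ : ℂ} {n : ℕ} {f : Fin 3 → ℝ → ℂ}

theorem hasDerivAt_logDeriv_next (h : IsTauLevel ξ n f) : ∀ᶠ t in codiscrete ℝ,
    HasDerivAt (logDeriv (tau ξ (n + 1))) (f 0 t * f 1 t) t := by
  filter_upwards [h.isTau.hasDerivAt_logDeriv, h.isTau.generic,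
    eventually_codiscrete_nhds h.one_eq] with t h1 ⟨_, _, h3, _⟩ h4
  have e : logDeriv (tau ξ (n + 1)) =ᶠ[𝓝 t] fun t => logDeriv (tau ξ n) t - f 1 t :=
    h4.mono fun s hs => by simp only [hs]; ring
  refine HasDerivAt.congr_of_eventuallyEq ?_ e
  convert! h1.sub h3 using 1
  ring

theorem toda (h : IsTauLevel ξ n f) : ∀ᶠ t in codiscrete ℝ,
    f 0 t * f 1 t + 2 * (n + 1) = tau ξ (n + 2) t * tau ξ n t / tau ξ (n + 1) t ^ 2 := by
  filter_upwards [h.hasDerivAt_logDeriv_next, h.next_ne_zero] with t h1 h2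
  rw [← (deriv_logDeriv_tau h2).1, h1.deriv]

/-- Where f₀ vanishes identically, its equation reads 0 = 2(n + 1). -/
theorem zero_ne_zero (h : IsTauLevel ξ n f) : ∀ᶠ t in codiscrete ℝ, f 0 t ≠ 0 := by
  refine Meromorphic.eventually_codiscrete_ne_zero (h.isTau.sol.mero 0) ?_
  filter_upwards [h.isTau.generic] with t ⟨_, h1, _⟩ h2
  have h3 : HasDerivAt (f 0) 0 t := (hasDerivAt_const t (0 : ℂ)).congr_of_eventuallyEq h2
  have h4 := h1.unique h3
  rw [h2.self_of_nhds, zero_mul, zero_add] at h4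
  norm_cast at h4

theorem hasDerivAt_pivot (h : IsTauLevel ξ n f) : ∀ᶠ t in codiscrete ℝ,
    HasDerivAt (fun t => f 0 t * f 1 t + 2 * ((n : ℂ) + 1))
      (f 0 t * f 1 t * (f 1 t - f 0 t) + 2 * (n + 1) * f 1 t) t := by
  filter_upwards [h.isTau.generic] with t ⟨_, h0, h1, _⟩
  convert! (h0.mul h1).add_const (2 * ((n : ℂ) + 1)) using 1
  ring

theorem pivot_ne_zero (h : IsTauLevel ξ n f) : ∀ᶠ t in codiscrete ℝ,
    f 0 t * f 1 t + 2 * ((n : ℂ) + 1) ≠ 0 := by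
  have hc : Meromorphic fun _ : ℝ => 2 * ((n : ℂ) + 1) := fun t => MeromorphicAt.const _ t
  refine Meromorphic.eventually_codiscrete_ne_zero
    (f := fun t => f 0 t * f 1 t + 2 * ((n : ℂ) + 1))
    (((h.isTau.sol.mero 0).mul (h.isTau.sol.mero 1)).add hc) ?_
  filter_upwards [h.hasDerivAt_pivot, h.zero_ne_zero] with t h1 h0 h2
  have h3 : HasDerivAt (fun t => f 0 t * f 1 t + 2 * ((n : ℂ) + 1)) 0 t :=
    (hasDerivAt_const t (0 : ℂ)).congr_of_eventuallyEq h2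
  have h4 := h1.unique h3
  have h5 : f 0 t * f 1 t + 2 * ((n : ℂ) + 1) = 0 := h2.self_of_nhds
  -- With K = f₀f₁ + 2(n+1), the derivative of K is f₁K - f₀²f₁; if K and K' vanish, substituting
  -- f₀f₁ = -2(n+1) leaves 2(n+1) f₀ = 0.
  have h6 : f 0 t * (2 * ((n : ℂ) + 1)) = 0 := by linear_combination h4 + (f 0 t - f 1 t) * h5
  have h7 : 2 * ((n : ℂ) + 1) ≠ 0 := by norm_cast
  exact (mul_ne_zero h0 h7) h6

theorem next_next_ne_zero (h : IsTauLevel ξ n f) :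
    ∀ᶠ t in codiscrete ℝ, tau ξ (n + 2) t ≠ 0 := by
  filter_upwards [h.pivot_ne_zero, h.toda] with t h1 h2 h3
  rw [h2, h3] at h1
  simp at h1

/-- The Bäcklund transformation of `f₁` is `(log (τ_{n+1} / τ_{n+2}))'`. -/
theorem sq_mul_eq (h : IsTauLevel ξ n f) : ∀ᶠ t in codiscrete ℝ, f 0 t ^ 2 * f 1 t =
    (logDeriv (tau ξ (n + 1)) t - logDeriv (tau ξ (n + 2)) t) *
      (f 0 t * f 1 t + 2 * (n + 1)) := by
  filter_upwards [eventually_codiscrete_nhds h.toda, h.hasDerivAt_pivot, h.pivot_ne_zero,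
    h.next_ne_zero, h.next_next_ne_zero, h.isTau.generic, h.one_eq]
    with t h1 h2 h3 h4 h5 ⟨_, _, _, _, h6, _⟩ h7
  have hd : ∀ n, DifferentiableAt ℝ (tau ξ n) t := fun n => (analyticAt_tau ξ n t).differentiableAt
  have e : logDeriv (fun t => f 0 t * f 1 t + 2 * ((n : ℂ) + 1)) t =
      logDeriv (tau ξ (n + 2)) t + logDeriv (tau ξ n) t - 2 * logDeriv (tau ξ (n + 1)) t := by
    have h1' : (fun t => f 0 t * f 1 t + 2 * ((n : ℂ) + 1)) =ᶠ[𝓝 t]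
      fun t => tau ξ (n + 2) t * tau ξ n t / tau ξ (n + 1) t ^ 2 := h1
    rw [logDeriv_apply, h1'.deriv_eq, h1'.eq_of_nhds, ← logDeriv_apply,
      logDeriv_div (f := fun t => tau ξ (n + 2) t * tau ξ n t) (g := fun t => tau ξ (n + 1) t ^ 2)
        t (mul_ne_zero h5 h6) (pow_ne_zero 2 h4) ((hd _).mul (hd _)) ((hd _).pow 2),
      logDeriv_mul t h5 h6 (hd _) (hd _), logDeriv_fun_pow (hd _)]
    push_cast; ring
  rw [logDeriv_apply, h2.deriv] at e
  have e2 := (div_eq_iff h3).1 e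
  linear_combination (-1 : ℂ) * e2 + (f 0 t * f 1 t + 2 * ((n : ℂ) + 1)) * h7

/-- The Bäcklund transformation raising `n`. -/
theorem next (h : IsTauLevel ξ n f) : ∃ F, IsTauLevel ξ (n + 1) F := by
  set K : ℝ → ℂ := fun t => f 0 t * f 1 t + 2 * ((n : ℂ) + 1) with hK
  have hc : Meromorphic fun _ : ℝ => 2 * ((n : ℂ) + 1) := fun t => MeromorphicAt.const _ t
  have hlin : Meromorphic fun t : ℝ => 2 * (t : ℂ) := fun t =>
    (analyticAt_const.mul (Complex.ofRealCLM.analyticAt t)).meromorphicAt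
  have m0 := h.isTau.sol.mero 0
  have m1 := h.isTau.sol.mero 1
  have mK : Meromorphic K := (m0.mul m1).add hc
  -- Equivalently F₂ = f₁ + 2(n+1)/f₀ and F₁ = f₀ - 2(n+1)/F₂: two reflections of the affine Weyl
  -- group combined with a rotation of the indices. The parameters move from (n+1, 0, -n) to (n+2,
  -- 0, -n-1).
  let F1 : ℝ → ℂ := fun t => f 0 t ^ 2 * f 1 t / K t
  let F2 : ℝ → ℂ := fun t => K t / f 0 t
  let F0 : ℝ → ℂ := fun t => 2 * t - F1 t - F2 t
  have mF1 : Meromorphic F1 := fun t =>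
    (((m0 t).pow 2).mul (m1 t)).div (mK t)
  have mF2 : Meromorphic F2 := mK.div m0
  have mF0 : Meromorphic F0 := (hlin.sub mF1).sub mF2
  have hF1 : ∀ᶠ t in codiscrete ℝ, HasDerivAt F1 (F1 t * (F2 t - F0 t)) t := by
    filter_upwards [h.isTau.generic, h.hasDerivAt_pivot, h.pivot_ne_zero, h.zero_ne_zero]
      with t ⟨hs, h0, h1, _⟩ hk hkn h0n
    convert! ((h0.pow 2).mul h1).div hk hkn using 1
    simp only [F0, F1, F2, hK, hs, Pi.pow_apply, Pi.mul_apply]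
    field_simp
    push_cast
    ring
  have hF2 : ∀ᶠ t in codiscrete ℝ,
      HasDerivAt F2 (F2 t * (F0 t - F1 t) - 2 * ((n : ℂ) + 1)) t := by
    filter_upwards [h.isTau.generic, h.hasDerivAt_pivot, h.pivot_ne_zero, h.zero_ne_zero]
      with t ⟨hs, h0, h1, _⟩ hk hkn h0n
    convert! hk.div h0 h0n using 1
    simp only [F0, F1, F2, hK, hs]
    field_simp
    ring
  have hF0 : ∀ᶠ t in codiscrete ℝ,
      HasDerivAt F0 (F0 t * (F1 t - F2 t) + 2 * ((n : ℂ) + 2)) t := by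
    filter_upwards [hF1, hF2] with t h1 h2
    convert! (((Complex.ofRealCLM.hasDerivAt (x := t)).const_mul (2 : ℂ)).sub h1).sub h2 using 1
    simp only [Complex.ofRealCLM_apply, Complex.ofReal_one]
    ring
  refine ⟨![F0, F1, F2], ⟨⟨?_, ?_, ?_, ?_, ?_, ?_⟩, ?_, ?_⟩, h.next_next_ne_zero, ?_⟩
  · simp [paramPIV]; ring
  · intro i; fin_cases i
    exacts [mF0, mF1, mF2]
  · refine fun t₀ => Eventually.of_forall fun t => ?_
    simp only [F0, Matrix.cons_val_zero, Matrix.cons_val_one, Matrix.cons_val]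
    ring
  · refine eventually_codiscrete_iff.1 (hF0.mono fun t ht => ?_)
    convert! ht using 1; simp [paramPIV]; ring
  · refine eventually_codiscrete_iff.1 (hF1.mono fun t ht => ?_)
    convert! ht using 1; simp [paramPIV]
  · refine eventually_codiscrete_iff.1 (hF2.mono fun t ht => ?_)
    convert! ht using 1; simp [paramPIV]; ring
  · exact eventually_codiscrete_iff.1 h.next_ne_zero
  · apply eventually_codiscrete_iff.1
    filter_upwards [h.next_ne_zero, h.isTau.generic, h.one_eq, h.pivot_ne_zero, h.zero_ne_zero]
      with t hn ⟨hs, _, _, _, _, hH⟩ h1 hkn h0n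
    convert! (analyticAt_tau ξ (n + 1) t).differentiableAt.hasDerivAt using 1
    have : deriv (tau ξ (n + 1)) t = logDeriv (tau ξ (n + 1)) t * tau ξ (n + 1) t := by
      rw [logDeriv_apply, div_mul_cancel₀ _ hn]
    -- The old Hamiltonian minus f₁ has to equal the new one in F; this is a rational identity in
    -- f₀, f₁ and t.
    have e : logDeriv (tau ξ (n + 1)) t =
      1 / 2 * f 0 t * f 1 t * f 2 t - n * f 1 t - f 1 t := by
      linear_combination hH + h1
    rw [this, e]
    congr 1
    simp only [hamiltonianPIV, paramPIV, F0, F1, F2, hK, hs, Matrix.cons_val_zero,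
      Matrix.cons_val_one, Matrix.cons_val]
    field_simp
    push_cast
    ring
  · filter_upwards [h.sq_mul_eq, h.pivot_ne_zero] with t h1 h2
    simp only [Matrix.cons_val_one, Matrix.cons_val_zero, F1, h1, hK]
    rw [mul_div_cancel_right₀ _ h2]

end IsTauLevel

/-! ### The seed solution and the induction on n -/

theorem tau_zero (ξ : ℂ) (t : ℝ) : tau ξ 0 t = 1 := by simp [tau]

theorem tau_one (ξ : ℂ) : tau ξ 1 = tauMoment ξ 0 := by ext t; simp [tau]

/-- Local vanishing would make the derivative (1 - ξ)e^{-t²} zero, forcing ξ = 1; but then τ₁ = √π.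
-/
theorem tau_one_ne_zero (ξ : ℂ) : ∀ᶠ t in codiscrete ℝ, tau ξ 1 t ≠ 0 := by
  refine Meromorphic.eventually_codiscrete_ne_zero
    (fun t => (analyticAt_tau ξ 1 t).meromorphicAt) (Eventually.of_forall fun t h => ?_)
  have h1 : HasDerivAt (tau ξ 1) 0 t := (hasDerivAt_const t (0 : ℂ)).congr_of_eventuallyEq h
  rw [tau_one] at h1
  have h2 := (hasDerivAt_tauMoment_zero ξ t).unique h1
  have h3 : ξ = 1 := by
    rcases mul_eq_zero.1 h2 with h | h
    · exact (sub_eq_zero.1 h).symm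
    · exact absurd h (Complex.exp_ne_zero _)
  have h4 := h.self_of_nhds
  rw [tau_one, h3, tauMoment_one_zero] at h4
  have : √Real.pi ≠ 0 := by positivity
  exact this (by exact_mod_cast h4)

/-- On the wall α₂ = 0 the choice f₂ = 0 is consistent and leaves the Riccati equation f₁' = -f₁(2t
- f₁), linearised by f₁ = -(log τ₁)'. -/
theorem exists_isTauLevel_zero (ξ : ℂ) : ∃ f, IsTauLevel ξ 0 f := by
  have hlin : Meromorphic fun t : ℝ => 2 * (t : ℂ) := fun t =>
    (analyticAt_const.mul (Complex.ofRealCLM.analyticAt t)).meromorphicAt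
  have hz : tau ξ 0 = fun _ => 1 := by ext t; exact tau_zero ξ t
  let f1 : ℝ → ℂ := fun t => -(((1 - ξ) * Complex.exp (-t ^ 2)) / tau ξ 1 t)
  let f0 : ℝ → ℂ := fun t => 2 * t - f1 t
  have hlog : ∀ t, logDeriv (tau ξ 1) t = -f1 t := by
    intro t
    simp only [logDeriv_apply, f1]
    have hτ := hasDerivAt_tauMoment_zero ξ t
    rw [← tau_one] at hτ
    rw [hτ.deriv, neg_neg]
  have m1 : Meromorphic f1 := by
    have : f1 = fun t => -(deriv (tau ξ 1) t / tau ξ 1 t) := by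
      ext t; rw [← logDeriv_apply, hlog]; ring
    rw [this]
    exact fun t => ((analyticAt_tau ξ 1 t).deriv.meromorphicAt.div
      (analyticAt_tau ξ 1 t).meromorphicAt).neg
  have hf1 : ∀ᶠ t in codiscrete ℝ, HasDerivAt f1 (f1 t * (0 - f0 t)) t := by
    filter_upwards [tau_one_ne_zero ξ] with t ht
    have hE : HasDerivAt (fun u : ℝ => Complex.exp (-(u : ℂ) ^ 2))
        (Complex.exp (-(t : ℂ) ^ 2) * (-(2 * t))) t := by
      have h1 : HasDerivAt (fun u : ℝ => -(u : ℂ) ^ 2) (-(2 * t)) t := by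
        convert! ((Complex.ofRealCLM.hasDerivAt (x := t)).pow 2).neg using 1
        simp
      exact h1.cexp
    have hτ := hasDerivAt_tauMoment_zero ξ t
    rw [← tau_one] at hτ
    convert! ((hE.const_mul (1 - ξ)).div hτ ht).neg using 1
    simp only [f0, f1]
    field_simp
    ring
  have hf0 : ∀ᶠ t in codiscrete ℝ, HasDerivAt f0 (f0 t * (f1 t - 0) + 2) t := by
    filter_upwards [hf1] with t h1
    convert! ((Complex.ofRealCLM.hasDerivAt (x := t)).const_mul (2 : ℂ)).sub h1 using 1
    simp only [Complex.ofRealCLM_apply, Complex.ofReal_one]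
    ring
  refine ⟨![f0, f1, fun _ => 0], ⟨⟨?_, ?_, ?_, ?_, ?_, ?_⟩, ?_, ?_⟩, tau_one_ne_zero ξ, ?_⟩
  · simp [paramPIV]
  · intro i; fin_cases i
    exacts [hlin.sub m1, m1, fun t => MeromorphicAt.const _ t]
  · intro t₀; exact Eventually.of_forall fun t => by simp [f0]
  · refine eventually_codiscrete_iff.1 (hf0.mono fun t ht => ?_)
    convert! ht using 1; simp [paramPIV]
  · refine eventually_codiscrete_iff.1 (hf1.mono fun t ht => ?_)
    convert! ht using 1; simp [paramPIV]
  · refine fun t₀ => Eventually.of_forall fun t => ?_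
    convert! hasDerivAt_const t (0 : ℂ) using 1; simp [paramPIV]
  · intro t₀; simp [hz]
  · refine fun t₀ => Eventually.of_forall fun t => ?_
    rw [hz]
    convert! hasDerivAt_const t (1 : ℂ) using 1; simp [paramPIV, hamiltonianPIV]
  · refine Eventually.of_forall fun t => ?_
    rw [hz, hlog]; simp

theorem exists_isTauLevel (ξ : ℂ) (n : ℕ) : ∃ f, IsTauLevel ξ n f := by
  induction n with
  | zero => exact exists_isTauLevel_zero ξ
  | succ n ih => exact ih.elim fun f h => h.next

theorem isClassicalTauSequence_tau (ξ : ℂ) : IsClassicalTauSequence 1 0 (tau ξ) where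
  zero := tau_zero ξ
  painleve n := (exists_isTauLevel ξ n).imp fun _ h => h.isTau
  smooth n := contDiff_iff_contDiffAt.2 fun t => (analyticAt_tau ξ n t).contDiffAt
  toda n hn t ht := by
    obtain ⟨n, rfl⟩ := Nat.exists_eq_add_of_le' hn
    exact (deriv_logDeriv_tau ht).2

/-- At `ξ = 1` the `τ`-functions are constant. -/
theorem tau_one_left (n : ℕ) : ∀ t, tau 1 n t =
    ((∏ k ∈ Finset.range n, √Real.pi * 2 ^ k * (k.factorial : ℝ) : ℝ) : ℂ) := by
  set c : ℕ → ℂ := fun n => ((∏ k ∈ Finset.range n, √Real.pi * 2 ^ k * (k.factorial : ℝ) : ℝ) : ℂ)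
    with hc
  change ∀ t, tau 1 n t = c n
  have hr : ∀ n, c (n + 1) = c n * (√Real.pi * 2 ^ n * n.factorial) := by
    intro n; simp only [hc, Finset.prod_range_succ]; push_cast; ring
  have hpi : ((√Real.pi : ℝ) : ℂ) ≠ 0 := by
    have : √Real.pi ≠ 0 := by positivity
    exact_mod_cast this
  have hne : ∀ n, c n ≠ 0 := by
    intro n
    simp only [hc]
    exact Complex.ofReal_ne_zero.2 (by positivity)
  induction n using Nat.twoStepInduction with
  | zero => intro t; simp [tau_zero, hc]
  | one => intro t; simp [tau_one, tauMoment_one_zero, hc]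
  | more n h0 h1 =>
    intro t
    -- For constant τ_{n+1}, Toda becomes 2(n+1) τ_{n+1}² = τ_{n+2}τ_n.
    have h := (deriv_logDeriv_tau (ξ := 1) (n := n) (t := t) (by rw [h1]; exact hne _)).1
    have hl : logDeriv (tau 1 (n + 1)) = fun _ => 0 := by
      have : tau 1 (n + 1) = fun _ => c (n + 1) := funext h1
      rw [this]; ext s; simp [logDeriv_apply]
    rw [hl, deriv_const, zero_add, h1, h0, eq_div_iff (pow_ne_zero 2 (hne _))] at h
    refine mul_right_cancel₀ (hne n) (h.symm.trans ?_)
    rw [hr (n + 1), hr n, Nat.factorial_succ]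
    push_cast; ring

/-! ### Relations between logarithmic derivatives, and the recurrence for g_n -/

theorem ContinuousAt.eq_of_eventually_codiscrete {F G : ℝ → ℂ} {t : ℝ} (hF : ContinuousAt F t)
    (hG : ContinuousAt G t) (h : ∀ᶠ s in codiscrete ℝ, F s = G s) : F t = G t :=
  tendsto_nhds_unique_of_eventuallyEq (hF.tendsto.mono_left nhdsWithin_le_nhds)
    (hG.tendsto.mono_left nhdsWithin_le_nhds) (eventually_codiscrete_iff.1 h t)

theorem analyticAt_logDeriv_tau {ξ : ℂ} {n : ℕ} {t : ℝ} (h : tau ξ n t ≠ 0) :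
    AnalyticAt ℝ (logDeriv (tau ξ n)) t :=
  (analyticAt_tau ξ n t).deriv.div (analyticAt_tau ξ n t) h

theorem continuousAt_ofReal_two_mul (t : ℝ) : ContinuousAt (fun t : ℝ => 2 * (t : ℂ)) t := by
  fun_prop

/-- The bilinear relation between `τ_n` and `τ_{n+1}`. -/
theorem deriv_logDeriv_tau_add {ξ : ℂ} {n : ℕ} {t : ℝ} (h0 : tau ξ n t ≠ 0)
    (h1 : tau ξ (n + 1) t ≠ 0) :
    deriv (logDeriv (tau ξ n)) t + deriv (logDeriv (tau ξ (n + 1))) t =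
      (logDeriv (tau ξ n) t - logDeriv (tau ξ (n + 1)) t) *
        (2 * t - (logDeriv (tau ξ n) t - logDeriv (tau ξ (n + 1)) t)) := by
  obtain ⟨f, hf⟩ := exists_isTauLevel ξ n
  have a0 := analyticAt_logDeriv_tau h0
  have a1 := analyticAt_logDeriv_tau h1
  have ad := (a0.sub a1).continuousAt
  -- The f's are controlled only at generic points. Written in τ alone, both sides are continuous at
  -- t, so the relation also holds there, including at t = 0.
  refine ContinuousAt.eq_of_eventually_codiscrete
    (F := fun t => deriv (logDeriv (tau ξ n)) t + deriv (logDeriv (tau ξ (n + 1))) t)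
    (G := fun t => (logDeriv (tau ξ n) t - logDeriv (tau ξ (n + 1)) t) *
        (2 * t - (logDeriv (tau ξ n) t - logDeriv (tau ξ (n + 1)) t)))
    (a0.deriv.add a1.deriv).continuousAt
    (ad.mul ((continuousAt_ofReal_two_mul t).sub ad)) ?_
  filter_upwards [hf.isTau.generic, hf.isTau.hasDerivAt_logDeriv, hf.hasDerivAt_logDeriv_next,
    hf.one_eq] with s ⟨hs, _⟩ h2 h3 h4
  rw [h2.deriv, h3.deriv, ← h4, hs]; ring

/-- This is `IsTauLevel.sq_mul_eq` multiplied by f₁, with f₀f₁ = (log τ_{n+1})''. -/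
theorem deriv_logDeriv_tau_sq {ξ : ℂ} {n : ℕ} {t : ℝ} (h0 : tau ξ n t ≠ 0)
    (h1 : tau ξ (n + 1) t ≠ 0) (h2 : tau ξ (n + 2) t ≠ 0) :
    deriv (logDeriv (tau ξ (n + 1))) t ^ 2 =
      (deriv (logDeriv (tau ξ (n + 1))) t + 2 * (n + 1)) *
        ((logDeriv (tau ξ n) t - logDeriv (tau ξ (n + 1)) t) *
          (logDeriv (tau ξ (n + 1)) t - logDeriv (tau ξ (n + 2)) t)) := by
  obtain ⟨f, hf⟩ := exists_isTauLevel ξ n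
  have a0 := analyticAt_logDeriv_tau h0
  have a1 := analyticAt_logDeriv_tau h1
  have a2 := analyticAt_logDeriv_tau h2
  refine ContinuousAt.eq_of_eventually_codiscrete
    (F := fun t => deriv (logDeriv (tau ξ (n + 1))) t ^ 2)
    (G := fun t => (deriv (logDeriv (tau ξ (n + 1))) t + 2 * (n + 1)) *
        ((logDeriv (tau ξ n) t - logDeriv (tau ξ (n + 1)) t) *
          (logDeriv (tau ξ (n + 1)) t - logDeriv (tau ξ (n + 2)) t)))
    (a1.deriv.pow 2).continuousAt
    ((a1.deriv.add analyticAt_const).mul ((a0.sub a1).mul (a1.sub a2))).continuousAt ?_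
  filter_upwards [hf.hasDerivAt_logDeriv_next, hf.one_eq, hf.sq_mul_eq] with s h3 h4 h5
  rw [h3.deriv, ← h4]
  linear_combination f 1 s * h5

theorem index_recurrence {ξ : ℂ} {n : ℕ} (h0 : tau ξ n 0 ≠ 0)
    (h1 : tau ξ (n + 1) 0 ≠ 0) (h2 : tau ξ (n + 2) 0 ≠ 0) :
    deriv (logDeriv (tau ξ (n + 1))) 0 ^ 4 =
      (2 * (n + 1) + deriv (logDeriv (tau ξ (n + 1))) 0) ^ 2 *
        (deriv (logDeriv (tau ξ (n + 1))) 0 + deriv (logDeriv (tau ξ n)) 0) *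
        (deriv (logDeriv (tau ξ (n + 1))) 0 + deriv (logDeriv (tau ξ (n + 2))) 0) := by
  have e1 := deriv_logDeriv_tau_add h0 h1
  have e2 := deriv_logDeriv_tau_add h1 h2
  have e3 := deriv_logDeriv_tau_sq h0 h1 h2
  rw [add_comm] at e1
  rw [e1, e2, show (4 : ℕ) = 2 * 2 from rfl, pow_mul, e3]
  push_cast
  ring

/-- H' = f₁f₂ holds for any admissible f, so near 0 the product is determined by τ_n alone. -/
theorem IsTauFunctionOf.tendsto_mul {ξ : ℂ} {n : ℕ} {f : Fin 3 → ℝ → ℂ}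
    (h : IsTauFunctionOf (paramPIV 1 0 n) f (tau ξ n)) (h0 : tau ξ n 0 ≠ 0) :
    Tendsto (fun t : ℝ => f 1 t * f 2 t) (𝓝[≠] 0) (𝓝 (deriv (logDeriv (tau ξ n)) 0)) := by
  have hc := ((analyticAt_logDeriv_tau h0).deriv.continuousAt.tendsto).mono_left
    (nhdsWithin_le_nhds (s := {0}ᶜ))
  exact hc.congr' ((eventually_codiscrete_iff.1 h.hasDerivAt_logDeriv 0).mono
    fun t ht => ht.deriv)

/-! ### The recurrence for τ_n -/

theorem eq_zero_of_forall_pos {F : ℂ → ℂ} (hF : Differentiable ℂ F)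
    (h : ∀ x : ℝ, 0 < x → F x = 0) (z : ℂ) : F z = 0 := by
  have ht : Tendsto (fun x : ℝ => (x : ℂ)) (𝓝[≠] 1) (𝓝[≠] 1) := by
    refine tendsto_nhdsWithin_of_tendsto_nhds_of_eventually_within _ ?_ ?_
    · exact (Complex.continuous_ofReal.tendsto' 1 1 (by simp)).mono_left nhdsWithin_le_nhds
    · filter_upwards [self_mem_nhdsWithin] with x hx
      simpa using hx
  have he : ∀ᶠ x : ℝ in 𝓝[≠] 1, F x = 0 :=
    nhdsWithin_le_nhds ((lt_mem_nhds one_pos).mono fun x hx => h x hx)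
  have hA : AnalyticOnNhd ℂ F Set.univ := fun z _ => hF.analyticAt z
  exact hA.eqOn_zero_of_preconnected_of_frequently_eq_zero isPreconnected_univ (Set.mem_univ 1)
    (ht.frequently he.frequently) (Set.mem_univ z)

theorem differentiable_tau (n : ℕ) (t : ℝ) : Differentiable ℂ fun ξ => tau ξ n t := by
  simp only [tau, Matrix.det_apply', Matrix.of_apply, tauMoment]
  fun_prop

/-- The left side of the recurrence for `τ_n(0; 0; ξ)`. -/
def recurrencePoly (n a b c d e : ℂ) : ℂ :=
  e * c ^ 3 * a + e * b ^ 2 * (d * b - (4 * n - 2) * c ^ 2)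
    + a * d ^ 2 * (d * b - (4 * n + 2) * c ^ 2)
    - 4 * (2 * n ^ 2 + 1) * d ^ 2 * c * b ^ 2 + 32 * n ^ 3 * d * c ^ 3 * b - 16 * n ^ 4 * c ^ 5

theorem recurrencePoly_tau_of_ne_zero {ξ : ℂ} (h : ∀ n, tau ξ n 0 ≠ 0) (m : ℕ) :
    recurrencePoly (m + 2) (tau ξ m 0) (tau ξ (m + 1) 0) (tau ξ (m + 2) 0) (tau ξ (m + 3) 0)
      (tau ξ (m + 4) 0) = 0 := by
  have g0 := eq_sub_of_add_eq (deriv_logDeriv_tau (h (m + 1))).1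
  have g1 := eq_sub_of_add_eq (deriv_logDeriv_tau (h (m + 1 + 1))).1
  have g2 := eq_sub_of_add_eq (deriv_logDeriv_tau (h (m + 1 + 1 + 1))).1
  have hr := index_recurrence (h (m + 1)) (h (m + 1 + 1)) (h (m + 1 + 2))
  rw [g0, g1] at hr
  rw [show m + 1 + 2 = m + 1 + 1 + 1 by ring, g2] at hr
  have hb := h (m + 1)
  have hc := h (m + 2)
  have hd := h (m + 3)
  simp only [show m + 1 + 1 = m + 2 by ring, show m + 2 + 1 = m + 3 by ring,
    show m + 2 + 2 = m + 4 by ring] at hr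
  generalize tau ξ m 0 = a at *
  generalize tau ξ (m + 1) 0 = b at *
  generalize tau ξ (m + 2) 0 = c at *
  generalize tau ξ (m + 3) 0 = d at *
  generalize tau ξ (m + 4) 0 = e at *
  have key := sub_eq_zero.2 hr.symm
  -- With x = bd/c² the middle g is x - 2(m+2). The prefactor x² clears the denominators b² and d²
  -- of the neighbouring g's, and the pure x⁴ and x³ terms cancel, so c⁵ clears the rest.
  refine (?_ : recurrencePoly (m + 2) a b c d e = c ^ 5 * _).trans
    ((congrArg (c ^ 5 * ·) key).trans (mul_zero _))
  rw [recurrencePoly]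
  field_simp
  push_cast
  ring

/-! ### Andréief's identity -/

theorem Matrix.sum_perm_sum_perm_eq {n : ℕ} (M : Matrix (Fin n) (Fin n) ℂ) :
    ∑ τ : Equiv.Perm (Fin n), ∑ σ : Equiv.Perm (Fin n),
      ((Equiv.Perm.sign σ : ℤ) : ℂ) * ((Equiv.Perm.sign τ : ℤ) : ℂ) * ∏ j, M (σ j) (τ j) =
    n.factorial * M.det := by
  have h : ∀ τ : Equiv.Perm (Fin n), ∑ σ : Equiv.Perm (Fin n),
      ((Equiv.Perm.sign σ : ℤ) : ℂ) * ((Equiv.Perm.sign τ : ℤ) : ℂ) * ∏ j, M (σ j) (τ j) =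
      M.det := by
    intro τ
    -- Replacing σ by στ removes τ from the product, since sign(τ)² = 1; the n! choices of τ then
    -- contribute equally.
    rw [Matrix.det_apply', ← Equiv.sum_comp (Equiv.mulRight τ)]
    refine Finset.sum_congr rfl fun σ _ => ?_
    have hs : ((Equiv.Perm.sign τ : ℤ) : ℂ) * ((Equiv.Perm.sign τ : ℤ) : ℂ) = 1 := by
      norm_cast; simp
    rw [Equiv.coe_mulRight, ← Equiv.prod_comp τ (fun j => M (σ j) j), Equiv.Perm.sign_mul]
    simp only [Units.val_mul, Int.cast_mul, Equiv.Perm.mul_apply]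
    linear_combination ((Equiv.Perm.sign σ : ℤ) : ℂ) * (∏ j, M (σ (τ j)) (τ j)) * hs
  rw [Finset.sum_congr rfl fun τ _ => h τ]
  simp [Fintype.card_perm]

theorem prod_mul_det_vandermonde_sq {n : ℕ} (v x : Fin n → ℂ) :
    (∏ j, v j) * (Matrix.vandermonde x).det ^ 2 =
      ∑ τ : Equiv.Perm (Fin n), ∑ σ : Equiv.Perm (Fin n),
        ((Equiv.Perm.sign σ : ℤ) : ℂ) * ((Equiv.Perm.sign τ : ℤ) : ℂ) *
          ∏ j, x j ^ ((σ j : ℕ) + (τ j : ℕ)) * v j := by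
  have h : (Matrix.vandermonde x).det =
      ∑ σ : Equiv.Perm (Fin n), ((Equiv.Perm.sign σ : ℤ) : ℂ) * ∏ j, x j ^ (σ j : ℕ) := by
    rw [← Matrix.det_transpose, Matrix.det_apply']; rfl
  rw [sq, h, Finset.sum_mul_sum, Finset.mul_sum, Finset.sum_comm]
  refine Finset.sum_congr rfl fun τ _ => ?_
  rw [Finset.mul_sum]
  refine Finset.sum_congr rfl fun σ _ => ?_
  simp only [pow_add, Finset.prod_mul_distrib]
  ring

/-- The Andréief identity for Hankel determinants. -/
theorem andreief {v : ℝ → ℂ} (hv : ∀ k : ℕ, Integrable fun x : ℝ => (x : ℂ) ^ k * v x) (n : ℕ) :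
    (Integrable fun x : Fin n → ℝ =>
      (∏ j, v (x j)) * (Matrix.vandermonde fun j => (x j : ℂ)).det ^ 2) ∧
    ∫ x : Fin n → ℝ, (∏ j, v (x j)) * (Matrix.vandermonde fun j => (x j : ℂ)).det ^ 2 =
      n.factorial * (Matrix.of fun i j : Fin n => ∫ x : ℝ, (x : ℂ) ^ ((i : ℕ) + j) * v x).det := by
  simp only [prod_mul_det_vandermonde_sq]
  have hI : ∀ τ σ : Equiv.Perm (Fin n), Integrable fun x : Fin n → ℝ =>
      ((Equiv.Perm.sign σ : ℤ) : ℂ) * ((Equiv.Perm.sign τ : ℤ) : ℂ) *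
          ∏ j, (x j : ℂ) ^ ((σ j : ℕ) + (τ j : ℕ)) * v (x j) := fun τ σ =>
    (Integrable.fintype_prod (μ := fun _ => volume)
      (f := fun (j : Fin n) (x : ℝ) => (x : ℂ) ^ ((σ j : ℕ) + (τ j : ℕ)) * v x)
      fun j => hv _).const_mul _
  refine ⟨integrable_finsetSum _ fun τ _ => integrable_finsetSum _ fun σ _ => hI τ σ, ?_⟩
  rw [integral_finsetSum _ fun τ _ => integrable_finsetSum _ fun σ _ => hI τ σ,
    ← Matrix.sum_perm_sum_perm_eq]
  refine Finset.sum_congr rfl fun τ _ => ?_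
  rw [integral_finsetSum _ fun σ _ => hI τ σ]
  refine Finset.sum_congr rfl fun σ _ => ?_
  rw [integral_const_mul]
  congr 1
  exact integral_fintype_prod_volume_eq_prod
    fun (j : Fin n) (x : ℝ) => (x : ℂ) ^ ((σ j : ℕ) + (τ j : ℕ)) * v x

/-- The Gaussian weight with a jump at the origin. -/
def jumpWeight (ξ : ℂ) (x : ℝ) : ℂ := Real.exp (-x ^ 2) * if 0 < x then ξ else 1

theorem integrable_pow_mul_exp_neg_sq (k : ℕ) :
    Integrable fun x : ℝ => x ^ k * Real.exp (-x ^ 2) := by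
  have h := integrable_rpow_mul_exp_neg_mul_sq (one_pos : (0 : ℝ) < 1) (s := k)
    (by have : (0 : ℝ) ≤ k := k.cast_nonneg
        linarith)
  simpa using h

theorem pow_mul_jumpWeight (ξ : ℂ) (k : ℕ) (x : ℝ) : (x : ℂ) ^ k * jumpWeight ξ x =
    (Set.Iic 0).indicator (fun x : ℝ => ((x ^ k * Real.exp (-x ^ 2) : ℝ) : ℂ)) x +
      ξ * (Set.Ioi 0).indicator (fun x : ℝ => ((x ^ k * Real.exp (-x ^ 2) : ℝ) : ℂ)) x := by
  by_cases hx : 0 < x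
  · simp [jumpWeight, hx]; ring
  · simp [jumpWeight, hx, not_lt.1 hx]

theorem integrable_pow_mul_jumpWeight (ξ : ℂ) (k : ℕ) :
    Integrable fun x : ℝ => (x : ℂ) ^ k * jumpWeight ξ x := by
  simp only [pow_mul_jumpWeight]
  have h : Integrable fun x : ℝ => ((x ^ k * Real.exp (-x ^ 2) : ℝ) : ℂ) :=
    (integrable_pow_mul_exp_neg_sq k).ofReal
  exact (h.indicator measurableSet_Iic).add ((h.indicator measurableSet_Ioi).const_mul ξ)

theorem tauMoment_apply_zero (ξ : ℂ) (k : ℕ) :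
    tauMoment ξ k 0 = (-1) ^ k * ∫ x : ℝ, (x : ℂ) ^ k * jumpWeight ξ x := by
  simp only [pow_mul_jumpWeight]
  have h : Integrable fun x : ℝ => ((x ^ k * Real.exp (-x ^ 2) : ℝ) : ℂ) :=
    (integrable_pow_mul_exp_neg_sq k).ofReal
  rw [integral_add (h.indicator measurableSet_Iic) ((h.indicator measurableSet_Ioi).const_mul ξ),
    integral_const_mul, integral_indicator measurableSet_Iic, integral_indicator measurableSet_Ioi,
    tauMoment]
  have e : ∀ x : ℝ, (0 - x) ^ k * Real.exp (-x ^ 2) = (-1) ^ k * (x ^ k * Real.exp (-x ^ 2)) := by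
    intro x; rw [zero_sub, neg_pow]; ring
  have hC : ∀ s : Set ℝ, ∫ x in s, ((x ^ k * Real.exp (-x ^ 2) : ℝ) : ℂ) =
    ((∫ x in s, x ^ k * Real.exp (-x ^ 2) : ℝ) : ℂ) := fun s => integral_ofReal
  simp only [e, integral_const_mul]
  rw [hC, hC]
  push_cast
  ring

theorem factorial_mul_tau_apply_zero (ξ : ℂ) (n : ℕ) :
    n.factorial / 2 ^ (n * (n - 1)) * tau ξ n 0 =
      ∫ x : Fin n → ℝ, (∏ j, jumpWeight ξ (x j)) *
        (Matrix.vandermonde fun j => (x j : ℂ)).det ^ 2 := by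
  rw [(andreief (integrable_pow_mul_jumpWeight ξ) n).2, tau]
  have e : (Matrix.of fun i j : Fin n => tauMoment ξ (i + j) 0) =
      Matrix.of fun i j : Fin n => (-1 : ℂ) ^ (i : ℕ) * (-1) ^ (j : ℕ) *
        (Matrix.of fun i j : Fin n => ∫ x : ℝ, (x : ℂ) ^ ((i : ℕ) + j) * jumpWeight ξ x) i j := by
    ext i j; simp [tauMoment_apply_zero, pow_add]
  -- At t = 0 the moments use (-x)^{i+j}; the signs from rows and columns cancel in the determinant.
  have h1 : (∏ i : Fin n, (-1 : ℂ) ^ (i : ℕ)) ^ 2 = 1 := by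
    rw [← Finset.prod_pow]
    exact Finset.prod_eq_one fun i _ => by rw [← pow_mul, mul_comm, pow_mul]; simp
  rw [e, Matrix.det_of_smul_smul, h1]
  field_simp

/-! ### The index generating function and the normalisation -/

/-- The number of positive coordinates. -/
def posCount {n : ℕ} (x : Fin n → ℝ) : ℕ := {j : Fin n | 0 < x j}.ncard

theorem posCount_eq {n : ℕ} (x : Fin n → ℝ) :
    posCount x = (Finset.univ.filter fun j => 0 < x j).card := by
  rw [posCount, ← Set.ncard_coe_finset]; simp

theorem measurable_posCount (n : ℕ) : Measurable (posCount (n := n)) := by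
  have : posCount (n := n) = fun x => ∑ j, if 0 < x j then 1 else 0 := by
    ext x; rw [posCount_eq, Finset.card_filter]
  rw [this]
  refine Finset.measurable_sum _ fun j _ => Measurable.ite ?_ measurable_const measurable_const
  exact measurableSet_lt measurable_const (measurable_pi_apply j)

theorem prod_jumpWeight_mul (ξ : ℂ) {n : ℕ} (x : Fin n → ℝ) :
    (∏ j, jumpWeight ξ (x j)) * (Matrix.vandermonde fun j => (x j : ℂ)).det ^ 2 =
      ξ ^ posCount x * (gueWeight n x : ℂ) := by
  have h1 : ∏ j, jumpWeight ξ (x j) = (Real.exp (-∑ j, x j ^ 2) : ℂ) * ξ ^ posCount x := by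
    simp only [jumpWeight, Finset.prod_mul_distrib]
    rw [Finset.prod_ite, Finset.prod_const, Finset.prod_const_one, mul_one, posCount_eq,
      ← Finset.sum_neg_distrib, Real.exp_sum]
    push_cast
    rfl
  rw [h1, Matrix.det_vandermonde, gueWeight, ← Finset.prod_pow]
  simp only [← Finset.prod_pow]
  push_cast
  rw [mul_comm _ (ξ ^ _), mul_assoc]
  congr 2
  exact Finset.prod_congr rfl fun i _ => Finset.prod_congr rfl fun j _ => by ring

theorem integrable_gueWeight (n : ℕ) : Integrable (gueWeight n) := by
  have h := (andreief (integrable_pow_mul_jumpWeight 1) n).1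
  simp only [prod_jumpWeight_mul, one_pow, one_mul] at h
  simpa using h.re

theorem gueWeight_nonneg (n : ℕ) (x : Fin n → ℝ) : 0 ≤ gueWeight n x :=
  mul_nonneg (Real.exp_pos _).le
    (Finset.prod_nonneg fun _ _ => Finset.prod_nonneg fun _ _ => sq_nonneg _)

theorem gueNorm_eq_tau (n : ℕ) :
    (gueNorm n : ℂ) = n.factorial / 2 ^ (n * (n - 1)) * tau 1 n 0 := by
  rw [factorial_mul_tau_apply_zero]
  simp only [prod_jumpWeight_mul, one_pow, one_mul]
  exact integral_ofReal.symm

theorem gueNorm_eq_prod (n : ℕ) : gueNorm n = n.factorial / 2 ^ (n * (n - 1)) *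
    ∏ k ∈ Finset.range n, √Real.pi * 2 ^ k * (k.factorial : ℝ) := by
  have h := gueNorm_eq_tau n
  rw [tau_one_left] at h
  apply Complex.ofReal_injective
  rw [h]
  push_cast
  rfl

theorem gueNorm_pos (n : ℕ) : 0 < gueNorm n := by
  rw [gueNorm_eq_prod]
  positivity

theorem gueNorm_eq (n : ℕ) : gueNorm n = (2 : ℝ) ^ (-((n : ℝ) * (n - 1)) / 2) *
    Real.pi ^ ((n : ℝ) / 2) * (n.factorial : ℝ) * ∏ k ∈ Finset.range n, (k.factorial : ℝ) := by
  have hs : (∑ k ∈ Finset.range n, (k : ℝ)) = n * (n - 1) / 2 := by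
    have := Finset.sum_range_id_mul_two n
    have h2 : ((∑ k ∈ Finset.range n, k : ℕ) : ℝ) * 2 = n * (n - 1) := by
      rcases n with _ | n
      · simp
      · rw [← Nat.cast_two, ← Nat.cast_mul, this]; push_cast [Nat.add_sub_cancel]; ring
    push_cast at h2
    linarith
  have h2 : ∏ k ∈ Finset.range n, (2 : ℝ) ^ k = (2 : ℝ) ^ ((n : ℝ) * (n - 1) / 2) := by
    rw [Finset.prod_pow_eq_pow_sum, ← hs, ← Real.rpow_natCast]; push_cast; rfl
  have h3 : (2 : ℝ) ^ (n * (n - 1)) = (2 : ℝ) ^ ((n : ℝ) * (n - 1)) := by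
    rw [← Real.rpow_natCast]
    congr 1
    rcases n with _ | n <;> simp
  have hpi : (√Real.pi) ^ n = Real.pi ^ ((n : ℝ) / 2) := by
    rw [Real.sqrt_eq_rpow, ← Real.rpow_natCast, ← Real.rpow_mul Real.pi_pos.le]; ring_nf
  rw [gueNorm_eq_prod, Finset.prod_mul_distrib, Finset.prod_mul_distrib, h2, h3,
    Finset.prod_const, Finset.card_range, hpi]
  have h4 : (2 : ℝ) ^ ((n : ℝ) * (n - 1) / 2) / (2 : ℝ) ^ ((n : ℝ) * (n - 1)) =
      (2 : ℝ) ^ (-((n : ℝ) * (n - 1)) / 2) := by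
    rw [← Real.rpow_sub two_pos]; ring_nf
  rw [← h4]; ring

/-- Split the Andréief integral according to the number of positive coordinates, on which the jump
weights depend only through ξ^k. -/
theorem sum_pow_mul_setIntegral (ξ : ℂ) (n : ℕ) :
    ∑ k ∈ Finset.range (n + 1), ξ ^ k *
      ((∫ x in {x : Fin n → ℝ | posCount x = k}, gueWeight n x : ℝ) : ℂ) =
    n.factorial / 2 ^ (n * (n - 1)) * tau ξ n 0 := by
  have hm : ∀ k, MeasurableSet {x : Fin n → ℝ | posCount x = k} := fun k =>
    measurable_posCount n (measurableSet_singleton k)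
  have hI : ∀ k, Integrable fun x => ξ ^ k * (((
      {x : Fin n → ℝ | posCount x = k}.indicator (gueWeight n) x : ℝ)) : ℂ) := fun k =>
    (((integrable_gueWeight n).indicator (hm k)).ofReal).const_mul _
  have e : ∀ k, ξ ^ k *
      ((∫ x in {x : Fin n → ℝ | posCount x = k}, gueWeight n x : ℝ) : ℂ) =
      ∫ x, ξ ^ k * (({x : Fin n → ℝ | posCount x = k}.indicator (gueWeight n) x : ℝ) : ℂ) := by
    intro k
    rw [integral_const_mul, ← integral_indicator (hm k)]
    exact congrArg _ integral_ofReal.symm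
  rw [Finset.sum_congr rfl fun k _ => e k, ← integral_finsetSum _ fun k _ => hI k,
    factorial_mul_tau_apply_zero]
  congr 1 with x
  rw [prod_jumpWeight_mul, Finset.sum_eq_single (posCount x)]
  · simp
  · intro k _ hk
    simp [Set.indicator, hk.symm]
  · intro h
    refine absurd (Finset.mem_range_succ_iff.2 ?_) h
    rw [posCount_eq]
    exact (Finset.card_le_univ _).trans (by simp)

theorem indexMGF_eq (n : ℕ) (s : ℂ) : indexMGF n s =
    (n.factorial : ℂ) / (2 ^ (n * (n - 1)) * (gueNorm n : ℂ)) * tau (Complex.exp (-s)) n 0 := by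
  have h := sum_pow_mul_setIntegral (Complex.exp (-s)) n
  have hN : (gueNorm n : ℂ) ≠ 0 := by exact_mod_cast (gueNorm_pos n).ne'
  rw [show (n.factorial : ℂ) / (2 ^ (n * (n - 1)) * (gueNorm n : ℂ)) * tau (Complex.exp (-s)) n 0 =
    (gueNorm n : ℂ)⁻¹ * (n.factorial / 2 ^ (n * (n - 1)) * tau (Complex.exp (-s)) n 0) by
      field_simp, ← h, indexMGF, Finset.mul_sum]
  refine Finset.sum_congr rfl fun k _ => ?_
  rw [indexProb, ← Complex.exp_nat_mul, mul_comm (-s)]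
  simp only [posCount]
  push_cast
  ring

/-- A vanishing sum of nonnegative terms ξ^k p_k would make every p_k zero, but they add up to N_n >
0. -/
theorem tau_ne_zero_of_pos {ξ : ℝ} (hξ : 0 < ξ) (n : ℕ) : tau (ξ : ℂ) n 0 ≠ 0 := by
  intro h0
  set p : ℕ → ℝ := fun k => ∫ x in {x : Fin n → ℝ | posCount x = k}, gueWeight n x with hp
  have hnn : ∀ k, 0 ≤ p k := fun k => integral_nonneg fun x => gueWeight_nonneg n x
  have h := sum_pow_mul_setIntegral ξ n
  rw [h0, mul_zero] at h
  have h' : ∑ k ∈ Finset.range (n + 1), ξ ^ k * p k = 0 := by exact_mod_cast h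
  rw [Finset.sum_eq_zero_iff_of_nonneg fun k _ => mul_nonneg (pow_pos hξ k).le (hnn k)] at h'
  have h1 := sum_pow_mul_setIntegral 1 n
  rw [← gueNorm_eq_tau] at h1
  have h1' : ∑ k ∈ Finset.range (n + 1), p k = gueNorm n := by
    simp only [one_pow, one_mul] at h1
    exact_mod_cast h1
  refine (gueNorm_pos n).ne' (h1'.symm.trans (Finset.sum_eq_zero fun k hk => ?_))
  exact (mul_eq_zero.1 (h' k hk)).resolve_left (pow_pos hξ k).ne'

/-- For fixed t the τ's are entire in ξ, so the case ξ > 0 suffices, even where some τ vanishes. -/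
theorem recurrencePoly_tau (ξ : ℂ) (m : ℕ) :
    recurrencePoly (m + 2) (tau ξ m 0) (tau ξ (m + 1) 0) (tau ξ (m + 2) 0) (tau ξ (m + 3) 0)
      (tau ξ (m + 4) 0) = 0 := by
  refine eq_zero_of_forall_pos (F := fun ξ => recurrencePoly (m + 2) (tau ξ m 0)
    (tau ξ (m + 1) 0) (tau ξ (m + 2) 0) (tau ξ (m + 3) 0) (tau ξ (m + 4) 0)) ?_
    (fun x hx => recurrencePoly_tau_of_ne_zero (tau_ne_zero_of_pos hx) m) ξ
  have h0 := differentiable_tau m 0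
  have h1 := differentiable_tau (m + 1) 0
  have h2 := differentiable_tau (m + 2) 0
  have h3 := differentiable_tau (m + 3) 0
  have h4 := differentiable_tau (m + 4) 0
  simp only [recurrencePoly]
  fun_prop

end

theorem mainTheorem5 :
    -- the value of the normalisation, with the Barnes function `G(n+1) = 0! 1! ⋯ (n-1)!`
    (∀ n : ℕ, gueNorm n = (2 : ℝ) ^ (-((n : ℝ) * (n - 1)) / 2) * Real.pi ^ ((n : ℝ) / 2)
      * (n.factorial : ℝ) * ∏ k ∈ Finset.range n, (k.factorial : ℝ)) ∧
    -- the generating function of the index as a Painlevé `τ`-function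
    (∀ (n : ℕ) (s : ℂ), indexMGF n s =
      (n.factorial : ℂ) / (2 ^ (n * (n - 1)) * (gueNorm n : ℂ)) * tau (Complex.exp (-s)) n 0) ∧
    (∀ ξ : ℂ, IsClassicalTauSequence 1 0 (tau ξ)) ∧
    -- the recurrence for the `τ`-functions at `t = 0`
    (∀ (ξ : ℂ) (τ : ℕ → ℂ), (∀ n, τ n = tau ξ n 0) → ∀ n : ℕ, 2 ≤ n →
      τ (n + 2) * τ n ^ 3 * τ (n - 2)
        + τ (n + 2) * τ (n - 1) ^ 2 * (τ (n + 1) * τ (n - 1) - (4 * n - 2) * τ n ^ 2)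
        + τ (n - 2) * τ (n + 1) ^ 2 * (τ (n + 1) * τ (n - 1) - (4 * n + 2) * τ n ^ 2)
        - 4 * (2 * n ^ 2 + 1) * τ (n + 1) ^ 2 * τ n * τ (n - 1) ^ 2
        + 32 * n ^ 3 * τ (n + 1) * τ n ^ 3 * τ (n - 1)
        - 16 * n ^ 4 * τ n ^ 5 = 0) ∧
    -- the recurrence for the products `g_n = f_{1,n} f_{2,n}` at `t = 0`
    (∀ ξ : ℝ, 0 < ξ → ∀ n : ℕ, tau (ξ : ℂ) n 0 ≠ 0) ∧
    (∀ (ξ : ℂ) (f : ℕ → Fin 3 → ℝ → ℂ),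
      (∀ n : ℕ, IsTauFunctionOf (paramPIV 1 0 n) (f n) (tau ξ n)) →
      ∃ g : ℕ → ℂ,
        (∀ n : ℕ, tau ξ n 0 ≠ 0 →
          Tendsto (fun t : ℝ => f n 1 t * f n 2 t) (𝓝[≠] 0) (𝓝 (g n))) ∧
        (∀ n : ℕ, 1 ≤ n → tau ξ (n - 1) 0 ≠ 0 → tau ξ n 0 ≠ 0 → tau ξ (n + 1) 0 ≠ 0 →
          g n ^ 4 = (2 * n + g n) ^ 2 * (g n + g (n - 1)) * (g n + g (n + 1)))) := by
  refine ⟨gueNorm_eq, indexMGF_eq, isClassicalTauSequence_tau, ?_,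
    fun ξ hξ n => tau_ne_zero_of_pos hξ n, ?_⟩
  · intro ξ τ hτ n hn
    obtain ⟨m, rfl⟩ := Nat.exists_eq_add_of_le' hn
    have h := recurrencePoly_tau ξ m
    simp only [← hτ] at h
    simpa [recurrencePoly] using h
  · intro ξ f hf
    -- The limit g_n is (log τ_n)''(0); where τ_n(0) = 0 its value is never used.
    refine ⟨fun n => deriv (logDeriv (tau ξ n)) 0, fun n hn => (hf n).tendsto_mul hn, ?_⟩
    intro n hn h0 h1 h2
    obtain ⟨m, rfl⟩ := Nat.exists_eq_add_of_le' hn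
    simpa using index_recurrence h0 h1 h2
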